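/- **Theorem (Milnor).** Let $\mathbb H^2$ be the hyperbolic plane, with unit tangent bundle $UT\mathbb H^2$ and orientation-preserving isometry group $PSL_2\mathbb R$, and let $\widetilde{PSL_2\mathbb R}$ be the universal covering group of $PSL_2\mathbb R$, whose elements are the homotopy classes (rel endpoints) of paths in $PSL_2\mathbb R$ that start at $1$. Let $\mathbf z\in\widetilde{PSL_2\mathbb R}$ be the class of the path $t\mapsto$ (anticlockwise rotation by $2\pi t$ about a fixed base point), $t\in[0,1]$; it generates the infinite cyclic group of lifts of $1\in PSL_2\mathbb R$. For $\tilde\alpha\in\widetilde{PSL_2\mathbb R}$ with image $\alpha\in PSL_2\mathbb R$ and for $p\in\mathbb H^2$, define $\operatorname{Twist}(\tilde\alpha,p)\in\mathbb R$ as follows. Let $c:[0,1]\to\mathbb H^2$ be the constant speed geodesic from $p$ to $\alpha(p)$, and let $\hat c$ be its unit tangent field (a constant unit vector if $\alpha(p)=p$). Choose a path $(f_t)$ in $PSL_2\mathbb R$ from $1$ to $\alpha$ in the class $\tilde\alpha$ with $f_t(p)=c(t)$, choose a unit tangent vector $V_0$ at $p$, and let $V(t)=(f_t)_*V_0$, a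 unit vector field along $c$. If $\theta(t)$ is a continuous choice of the angle from $\hat c(t)$ to $V(t)$, measured anticlockwise, then $\operatorname{Twist}(\tilde\alpha,p)=\theta(1)-\theta(0)$; this does not depend on the choices. Let $g,n\ge 0$ be integers with $2-2g-n<0$, let $p\in\mathbb H^2$, and let $\tilde\alpha_1,\tilde\beta_1,\dots,\tilde\alpha_g,\tilde\beta_g,\tilde\gamma_1,\dots,\tilde\gamma_n\in\widetilde{PSL_2\mathbb R}$ have images $\alpha_i,\beta_i,\gamma_j\in PSL_2\mathbb R$. Suppose that $|\operatorname{Twist}(\tilde\gamma_j,p)|\le\pi$ for all $j$ and that $$[\alpha_1,\beta_1]\cdots[\alpha_g,\beta_g]\,\gamma_1\cdots\gamma_n=1\in PSL_2\mathbb R,\qquad [x,y]=xyx^{-1}y^{-1}.$$ Then $$[\tilde\alpha_1,\tilde\beta_1]\cdots[\tilde\alpha_g,\tilde\beta_g]\,\tilde\gamma_1\cdots\tilde\gamma_n=\mathbf z^m$$ for an integer $m$ with $|m|\le 2g+n-2=|2-2g-n|$; here $2-2g-n=\chi(S)$ is the Euler characteristic of the compact orientable surface $S$ of genus $g$ with $n$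 boundary components. -/

import Mathlib

open scoped MatrixGroups UpperHalfPlane unitInterval

noncomputable section

/-! ### The universal covering group of a topological group -/

section UniversalCover

variable (G : Type*) [Group G] [TopologicalSpace G] [IsTopologicalGroup G]

/-- The group of paths `[0,1] → G` that start at the identity, under pointwise multiplication. -/
def PathsFromOne : Subgroup C(I, G) where
  carrier := {f | f 0 = 1}
  one_mem' := rfl
  mul_mem' {f g} hf hg := by
    change f 0 * g 0 = 1
    rw [show f 0 = 1 from hf, show g 0 = 1 from hg, mul_one]
  inv_mem' {f} hf := by
    change (f 0)⁻¹ = 1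
    rw [show f 0 = 1 from hf, inv_one]

/-- Homotopy relative to the endpoints, as a congruence on the group of paths from `1`. -/
def pathHomotopy : Con (PathsFromOne G) where
  r f g := ContinuousMap.HomotopicRel (f : C(I, G)) (g : C(I, G)) {0, 1}
  iseqv :=
    ⟨fun _ => ContinuousMap.HomotopicRel.refl _, fun h => h.symm, fun h k => h.trans k⟩
  mul' {f₁ f₂ g₁ g₂} h k := by
    obtain ⟨H⟩ := h
    obtain ⟨K⟩ := k
    exact ⟨{
      toContinuousMap := H.toContinuousMap * K.toContinuousMap
      map_zero_left := fun x => congrArg₂ (· * ·) (H.map_zero_left x) (K.map_zero_left x)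
      map_one_left := fun x => congrArg₂ (· * ·) (H.map_one_left x) (K.map_one_left x)
      prop' := fun t x hx => congrArg₂ (· * ·) (H.prop' t x hx) (K.prop' t x hx) }⟩

/-- The universal covering group of a (connected, locally nice) topological group `G`: homotopy
classes, relative to the endpoints, of paths in `G` starting at `1`. The group law is induced by
pointwise multiplication of paths. -/
abbrev UniversalCover : Type _ := (pathHomotopy G).Quotient

variable {G}

/-- The element of the universal cover that a path from `1` represents. -/
def UniversalCover.mk (f : PathsFromOne G) : UniversalCover G := (f : (pathHomotopy G).Quotient)

/-- The covering projection `[f] ↦ f(1)`. -/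
def UniversalCover.proj : UniversalCover G →* G :=
  (pathHomotopy G).lift
    { toFun := fun f => (f : C(I, G)) 1
      map_one' := rfl
      map_mul' := fun _ _ => rfl }
    (fun _ _ h => ContinuousMap.HomotopicRel.fst_eq_snd h (Or.inr rfl))

end UniversalCover

/-! ### The unit tangent bundle of the hyperbolic plane -/

/-- The unit tangent bundle of the hyperbolic plane, in the upper half plane model: a tangent
vector `vec` at `pt` has hyperbolic length `‖vec‖ / Im pt`. -/
@[ext]
structure UnitTangent where
  pt : ℍ
  vec : ℂ
  norm_vec : ‖vec‖ = pt.im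

namespace UnitTangent

/-- The derivative at `z` of the fractional linear transformation
`w ↦ (a w + b) / (c w + d)` given by `g ∈ SL₂(ℝ)`, namely `1 / (c z + d)²`. -/
def moebiusDeriv (g : SL(2, ℝ)) (z : ℍ) : ℂ := 1 / ((g 1 0 : ℂ) * z + (g 1 1 : ℂ)) ^ 2

lemma moebius_denom_ne_zero (g : SL(2, ℝ)) (z : ℍ) : (g 1 0 : ℂ) * z + (g 1 1 : ℂ) ≠ 0 :=
  UpperHalfPlane.denom_ne_zero (g : GL (Fin 2) ℝ) z

lemma hasDerivAt_moebius (g : SL(2, ℝ)) (z : ℍ) :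
    HasDerivAt
      (fun w : ℂ => ((g 0 0 : ℂ) * w + (g 0 1 : ℂ)) / ((g 1 0 : ℂ) * w + (g 1 1 : ℂ)))
      (moebiusDeriv g z) (z : ℂ) := by
  have h0 := moebius_denom_ne_zero g z
  have h1 : HasDerivAt (fun w : ℂ => (g 0 0 : ℂ) * w + (g 0 1 : ℂ)) (g 0 0 : ℂ) (z : ℂ) := by
    simpa using ((hasDerivAt_id (z : ℂ)).const_mul (g 0 0 : ℂ)).add_const (g 0 1 : ℂ)
  have h2 : HasDerivAt (fun w : ℂ => (g 1 0 : ℂ) * w + (g 1 1 : ℂ)) (g 1 0 : ℂ) (z : ℂ) := by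
    simpa using ((hasDerivAt_id (z : ℂ)).const_mul (g 1 0 : ℂ)).add_const (g 1 1 : ℂ)
  have hd : (g 0 0 : ℂ) * (g 1 1 : ℂ) - (g 0 1 : ℂ) * (g 1 0 : ℂ) = 1 := by
    have := g.det_coe
    rw [Matrix.det_fin_two] at this
    exact_mod_cast this
  have e : moebiusDeriv g z =
      ((g 0 0 : ℂ) * ((g 1 0 : ℂ) * z + (g 1 1 : ℂ)) -
        ((g 0 0 : ℂ) * z + (g 0 1 : ℂ)) * (g 1 0 : ℂ)) /
          ((g 1 0 : ℂ) * z + (g 1 1 : ℂ)) ^ 2 := by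
    rw [moebiusDeriv]
    congr 1
    linear_combination -hd
  rw [e]
  exact h1.div h2 h0

lemma coe_sl_smul (g : SL(2, ℝ)) (z : ℍ) :
    ((g • z : ℍ) : ℂ) = ((g 0 0 : ℂ) * z + (g 0 1 : ℂ)) / ((g 1 0 : ℂ) * z + (g 1 1 : ℂ)) := by
  simpa using UpperHalfPlane.coe_specialLinearGroup_apply g z

lemma norm_moebiusDeriv_mul (g : SL(2, ℝ)) (V : UnitTangent) :
    ‖moebiusDeriv g V.pt * V.vec‖ = (g • V.pt).im := by
  have h : (g • V.pt).im =
      |(g : GL (Fin 2) ℝ).det.val| * V.pt.im /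
        Complex.normSq ((g 1 0 : ℂ) * V.pt + (g 1 1 : ℂ)) :=
    UpperHalfPlane.im_smul_eq_div_normSq (g : GL (Fin 2) ℝ) V.pt
  rw [h, norm_mul, V.norm_vec, moebiusDeriv, Complex.normSq_eq_norm_sq, norm_div, norm_one,
    norm_pow]
  simp
  ring

lemma moebiusDeriv_one (z : ℍ) : moebiusDeriv 1 z = 1 := by
  simp [moebiusDeriv]

lemma moebiusDeriv_mul (g h : SL(2, ℝ)) (z : ℍ) :
    moebiusDeriv (g * h) z = moebiusDeriv g (h • z) * moebiusDeriv h z := by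
  have h0 := moebius_denom_ne_zero h z
  have h1 := moebius_denom_ne_zero g (h • z)
  unfold moebiusDeriv
  rw [div_mul_div_comm, one_mul, ← mul_pow]
  congr 2
  rw [coe_sl_smul, add_mul, mul_assoc, div_mul_cancel₀ _ (moebius_denom_ne_zero h z)]
  simp [Matrix.mul_apply, Fin.sum_univ_two]
  ring

/-- `SL₂(ℝ)` acts on unit tangent vectors by the differentials of the fractional linear
transformations: `g • (z, v) = (g z, g'(z) v)`. -/
instance slAction : MulAction SL(2, ℝ) UnitTangent where
  smul g V := ⟨g • V.pt, moebiusDeriv g V.pt * V.vec, norm_moebiusDeriv_mul g V⟩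
  one_smul V := by
    ext1
    · exact one_smul _ V.pt
    · change moebiusDeriv 1 V.pt * V.vec = V.vec
      rw [moebiusDeriv_one, one_mul]
  mul_smul g h V := by
    ext1
    · exact mul_smul g h V.pt
    · change moebiusDeriv (g * h) V.pt * V.vec =
        moebiusDeriv g (h • V.pt) * (moebiusDeriv h V.pt * V.vec)
      rw [moebiusDeriv_mul, mul_assoc]

lemma center_smul (g : SL(2, ℝ)) (hg : g ∈ Subgroup.center SL(2, ℝ)) (V : UnitTangent) :
    g • V = V := by
  obtain ⟨r, hr, hrg⟩ := Matrix.SpecialLinearGroup.mem_center_iff.mp hg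
  have h2 : r ^ 2 = 1 := by simpa using hr
  have hc : (r : ℂ) ^ 2 = 1 := by exact_mod_cast h2
  have hr0 : (r : ℂ) ≠ 0 := by rintro h; simp [h] at hc
  have e00 : g 0 0 = r := by rw [← hrg]; simp
  have e01 : g 0 1 = 0 := by rw [← hrg]; simp
  have e10 : g 1 0 = 0 := by rw [← hrg]; simp
  have e11 : g 1 1 = r := by rw [← hrg]; simp
  ext1
  · change g • V.pt = V.pt
    ext1
    rw [coe_sl_smul, e00, e01, e10, e11]
    simp [hr0]
  · change moebiusDeriv g V.pt * V.vec = V.vec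
    rw [moebiusDeriv, e10, e11]
    simp [hc]

/-- The induced action of `PSL₂(ℝ)`, the group of orientation-preserving isometries of the
hyperbolic plane, on unit tangent vectors. -/
instance pslAction : MulAction PSL(2, ℝ) UnitTangent :=
  MulAction.ofEndHom <|
    QuotientGroup.lift (Subgroup.center SL(2, ℝ)) MulAction.toEndHom fun g hg =>
      funext fun V => center_smul g hg V

lemma psl_mk_smul (g : SL(2, ℝ)) (V : UnitTangent) : (g : PSL(2, ℝ)) • V = g • V := rfl

/-- Rotate a unit tangent vector anticlockwise by the angle `θ`. -/
def rotate (θ : ℝ) (V : UnitTangent) : UnitTangent where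
  pt := V.pt
  vec := Complex.exp (θ * Complex.I) * V.vec
  norm_vec := by rw [norm_mul, Complex.norm_exp_ofReal_mul_I, one_mul, V.norm_vec]

/-- The unit tangent vector at `i eˢ` that points vertically upwards. -/
def vertical (s : ℝ) : UnitTangent where
  pt := ⟨Real.exp s * Complex.I, by
    simpa [-Complex.ofReal_exp] using Real.exp_pos s⟩
  vec := Real.exp s * Complex.I
  norm_vec := by
    rw [norm_mul, Complex.norm_I, mul_one, Complex.norm_real, Real.norm_eq_abs,
      abs_of_pos (Real.exp_pos s), ← UpperHalfPlane.coe_im]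
    simp [-Complex.ofReal_exp]

end UnitTangent

open UnitTangent

/-- The unit tangent field of the geodesic `t ↦ h (i e^{d t})` of constant speed `d ≥ 0`, the image
of the imaginary axis under the isometry `h`. If `d = 0`, this is a constant curve with a constant
unit vector. -/
def geodesicField (h : SL(2, ℝ)) (d : ℝ) (t : ℝ) : UnitTangent := h • vertical (d * t)

lemma dist_geodesicField (h : SL(2, ℝ)) (d s t : ℝ) :
    dist (geodesicField h d s).pt (geodesicField h d t).pt = |d| * |s - t| := by
  change dist (h • (vertical (d * s)).pt) (h • (vertical (d * t)).pt) = _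
  rw [dist_smul]
  have e : ∀ u : ℝ, (vertical u).pt = UpperHalfPlane.mk ⟨0, Real.exp u⟩ (Real.exp_pos u) := by
    intro u
    apply UpperHalfPlane.ext
    apply Complex.ext <;> simp [vertical, -Complex.ofReal_exp]
  rw [e, e, (UpperHalfPlane.isometry_vertical_line 0).dist_eq, Real.dist_eq, ← abs_mul, mul_sub]

lemma hasDerivAt_geodesicField (h : SL(2, ℝ)) (d t : ℝ) :
    HasDerivAt (fun t : ℝ => ((geodesicField h d t).pt : ℂ))
      (d * (geodesicField h d t).vec) t := by
  have h1 : HasDerivAt (fun t : ℝ => ((vertical (d * t)).pt : ℂ))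
      (d * (vertical (d * t)).vec) t := by
    have h0 : HasDerivAt (fun t : ℝ => Real.exp (d * t)) (Real.exp (d * t) * d) t := by
      simpa using ((hasDerivAt_id t).const_mul d).exp
    have h2 := (h0.ofReal_comp).mul_const Complex.I
    have e2 : (d : ℂ) * (vertical (d * t)).vec =
        ((Real.exp (d * t) * d : ℝ) : ℂ) * Complex.I := by
      change (d : ℂ) * ((Real.exp (d * t) : ℝ) * Complex.I) = _
      push_cast
      ring
    rw [e2]
    exact h2
  have h3 := (hasDerivAt_moebius h (vertical (d * t)).pt).comp t h1
  have e3 : (fun t : ℝ => ((geodesicField h d t).pt : ℂ)) =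
      (fun w : ℂ => ((h 0 0 : ℂ) * w + (h 0 1 : ℂ)) / ((h 1 0 : ℂ) * w + (h 1 1 : ℂ))) ∘
        fun t : ℝ => ((vertical (d * t)).pt : ℂ) :=
    funext fun s => coe_sl_smul h (vertical (d * s)).pt
  have e4 : (d : ℂ) * (geodesicField h d t).vec =
      moebiusDeriv h (vertical (d * t)).pt * (d * (vertical (d * t)).vec) := by
    change (d : ℂ) * (moebiusDeriv h (vertical (d * t)).pt * (vertical (d * t)).vec) = _
    ring
  rw [e3, e4]
  exact h3

/-- `τ` is the twist of the unit vector field `V` along the curve with unit tangent field `c`: the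
total change of a continuous choice `θ` of the angle, measured anticlockwise, from `c` to `V`. -/
def IsFieldTwist (c V : I → UnitTangent) (τ : ℝ) : Prop :=
  ∃ θ : C(I, ℝ), (∀ t, V t = (c t).rotate (θ t)) ∧ τ = θ 1 - θ 0

/-- `τ` is the twist of `a` at `y`: the twist of `V` along `c`, where `c` is the constant speed
geodesic from `y` to its image under the projection of `a`, and `V t = f t • V₀` is a unit vector
field along `c` that lies in the homotopy class `a`. -/
def IsTwist (a : UniversalCover PSL(2, ℝ)) (y : ℍ) (τ : ℝ) : Prop :=
  ∃ (h : SL(2, ℝ)) (d : ℝ) (f : PathsFromOne PSL(2, ℝ)) (V₀ : UnitTangent),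
    0 ≤ d ∧ V₀.pt = y ∧ UniversalCover.mk f = a ∧
      IsFieldTwist (fun t => geodesicField h d t) (fun t => (f : C(I, PSL(2, ℝ))) t • V₀) τ

/-- The matrix `[[cos φ, sin φ], [-sin φ, cos φ]]`, which rotates the hyperbolic plane about `i`
anticlockwise through the angle `2φ`. -/
def rotationMatrix (φ : ℝ) : SL(2, ℝ) :=
  ⟨!![Real.cos φ, Real.sin φ; -Real.sin φ, Real.cos φ], by
    rw [Matrix.det_fin_two_of]
    nlinarith [Real.sin_sq_add_cos_sq φ]⟩

lemma continuous_rotationMatrix : Continuous rotationMatrix := by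
  refine Continuous.subtype_mk (continuous_matrix fun i j => ?_) _
  fin_cases i <;> fin_cases j <;> simp <;> fun_prop

lemma rotationMatrix_smul (φ : ℝ) (V : UnitTangent) (hV : V.pt = UpperHalfPlane.I) :
    rotationMatrix φ • V = V.rotate (2 * φ) := by
  have h : (Complex.cos φ - Complex.sin φ * Complex.I) *
      (Complex.cos φ + Complex.sin φ * Complex.I) = 1 := by
    linear_combination Complex.sin_sq_add_cos_sq (φ : ℂ) - Complex.sin φ ^ 2 * Complex.I_sq
  have h0 := left_ne_zero_of_mul_eq_one h
  ext1
  · change rotationMatrix φ • V.pt = V.pt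
    apply UpperHalfPlane.ext
    rw [coe_sl_smul, hV]
    simp only [rotationMatrix]
    simp
    rw [div_eq_iff (by simpa [sub_eq_neg_add] using h0)]
    linear_combination (Complex.sin φ) * Complex.I_sq
  · change moebiusDeriv (rotationMatrix φ) V.pt * V.vec = Complex.exp _ * V.vec
    rw [moebiusDeriv, hV]
    have e : Complex.exp (((2 * φ : ℝ) : ℂ) * Complex.I) =
        (Complex.cos φ + Complex.sin φ * Complex.I) ^ 2 := by
      rw [← Complex.exp_mul_I, ← Complex.exp_nat_mul]
      congr 1
      push_cast
      ring
    rw [e]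
    congr 1
    rw [div_eq_iff]
    · simp [rotationMatrix]
      linear_combination (-1 - (Complex.cos φ - Complex.sin φ * Complex.I) *
        (Complex.cos φ + Complex.sin φ * Complex.I)) * h
    · simpa [rotationMatrix, sub_eq_neg_add] using h0

/-- The path `t ↦ ±[[cos πt, sin πt], [-sin πt, cos πt]]` in `PSL₂(ℝ)`. It turns the unit tangent
vectors at `i` anticlockwise, at time `t` through `2πt`. -/
def rotationPath : PathsFromOne PSL(2, ℝ) where
  val :=
    { toFun := fun t => (rotationMatrix (Real.pi * t) : PSL(2, ℝ))
      continuous_toFun := QuotientGroup.continuous_mk.comp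
        (continuous_rotationMatrix.comp (by fun_prop)) }
  property := by
    have : rotationMatrix (Real.pi * ((0 : I) : ℝ)) = 1 := by
      ext i j
      fin_cases i <;> fin_cases j <;> simp [rotationMatrix]
    change ((rotationMatrix (Real.pi * ((0 : I) : ℝ)) : SL(2, ℝ)) : PSL(2, ℝ)) = 1
    rw [this]
    rfl

lemma rotationPath_smul (t : I) (V : UnitTangent) (hV : V.pt = UpperHalfPlane.I) :
    (rotationPath : C(I, PSL(2, ℝ))) t • V = V.rotate (2 * (Real.pi * t)) :=
  rotationMatrix_smul _ V hV

/-- The generator `z` of the group of lifts of `1`: one full anticlockwise turn. -/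
def zGen : UniversalCover PSL(2, ℝ) := UniversalCover.mk rotationPath

/-! ### Existence and uniqueness of the twist -/

namespace UnitTangent

lemma im_pt_ne_zero (V : UnitTangent) : (V.pt.im : ℂ) ≠ 0 := by
  exact_mod_cast V.pt.im_pos.ne'

/-- The Euclidean direction of a unit tangent vector. -/
def dir (V : UnitTangent) : Circle :=
  ⟨V.vec / V.pt.im, by
    change V.vec / (V.pt.im : ℂ) ∈ Metric.sphere (0 : ℂ) 1
    rw [mem_sphere_zero_iff_norm, norm_div, V.norm_vec, Complex.norm_real, Real.norm_eq_abs,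
      abs_of_pos V.pt.im_pos, div_self V.pt.im_pos.ne']⟩

lemma coe_dir (V : UnitTangent) : (V.dir : ℂ) = V.vec / V.pt.im := rfl

lemma dir_rotate (θ : ℝ) (V : UnitTangent) : (V.rotate θ).dir = Circle.exp θ * V.dir := by
  apply Circle.ext
  rw [Circle.coe_mul, Circle.coe_exp, coe_dir, coe_dir]
  exact mul_div_assoc _ _ _

lemma eq_of_dir {V W : UnitTangent} (h : V.pt = W.pt) (hd : V.dir = W.dir) : V = W := by
  ext1
  · exact h
  · have h1 : (V.dir : ℂ) = W.dir := by rw [hd]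
    rw [coe_dir, coe_dir, h] at h1
    exact (div_left_inj' W.im_pt_ne_zero).mp h1

lemma exists_rotate {V W : UnitTangent} (h : V.pt = W.pt) : ∃ φ : ℝ, W = V.rotate φ := by
  refine ⟨Complex.arg (W.dir * V.dir⁻¹ : Circle), eq_of_dir h.symm ?_⟩
  rw [dir_rotate, Circle.exp_arg, inv_mul_cancel_right]

lemma sl_smul_rotate (g : SL(2, ℝ)) (θ : ℝ) (V : UnitTangent) :
    g • V.rotate θ = (g • V).rotate θ := by
  ext1
  · rfl
  · change moebiusDeriv g V.pt * (Complex.exp _ * V.vec) =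
      Complex.exp _ * (moebiusDeriv g V.pt * V.vec)
    ring

lemma psl_smul_rotate (g : PSL(2, ℝ)) (θ : ℝ) (V : UnitTangent) :
    g • V.rotate θ = (g • V).rotate θ := by
  induction g using QuotientGroup.induction_on with
  | H g => exact sl_smul_rotate g θ V

lemma continuous_entry (i j : Fin 2) : Continuous fun g : SL(2, ℝ) => g i j :=
  (Continuous.matrix_elem continuous_id i j).comp continuous_subtype_val

lemma sl_smul_pt (g : SL(2, ℝ)) (V : UnitTangent) : (g • V).pt = g • V.pt := rfl

lemma continuous_sl_smul {X : Type*} [TopologicalSpace X] {a : X → SL(2, ℝ)} {b : X → ℍ}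
    (ha : Continuous a) (hb : Continuous b) : Continuous fun x => a x • b x := by
  rw [UpperHalfPlane.isEmbedding_coe.continuous_iff]
  have e : (UpperHalfPlane.coe ∘ fun x => a x • b x) = fun x =>
      ((a x 0 0 : ℂ) * b x + (a x 0 1 : ℂ)) / ((a x 1 0 : ℂ) * b x + (a x 1 1 : ℂ)) :=
    funext fun x => coe_sl_smul (a x) (b x)
  rw [e]
  have hc (i j : Fin 2) : Continuous fun x => (a x i j : ℂ) :=
    Complex.continuous_ofReal.comp ((continuous_entry i j).comp ha)
  have hz : Continuous fun x => (b x : ℂ) := UpperHalfPlane.continuous_coe.comp hb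
  exact (((hc 0 0).mul hz).add (hc 0 1)).div (((hc 1 0).mul hz).add (hc 1 1))
    fun x => moebius_denom_ne_zero (a x) (b x)

lemma continuous_psl_pt (V : UnitTangent) : Continuous fun g : PSL(2, ℝ) => (g • V).pt := by
  rw [(QuotientGroup.isQuotientMap_mk (Subgroup.center SL(2, ℝ))).continuous_iff]
  exact continuous_sl_smul continuous_id continuous_const

lemma continuous_psl_dir (V : UnitTangent) : Continuous fun g : PSL(2, ℝ) => (g • V).dir := by
  rw [(QuotientGroup.isQuotientMap_mk (Subgroup.center SL(2, ℝ))).continuous_iff]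
  refine Continuous.subtype_mk (Continuous.div ?_ ?_ fun g => im_pt_ne_zero _) _
  · change Continuous fun g : SL(2, ℝ) => moebiusDeriv g V.pt * V.vec
    unfold moebiusDeriv
    have hc (i j : Fin 2) : Continuous fun g : SL(2, ℝ) => (g i j : ℂ) :=
      Complex.continuous_ofReal.comp (continuous_entry i j)
    exact (Continuous.div continuous_const
      ((((hc 1 0).mul continuous_const).add (hc 1 1)).pow 2)
      fun g => pow_ne_zero 2 (moebius_denom_ne_zero g V.pt)).mul continuous_const
  · exact Complex.continuous_ofReal.comp (UpperHalfPlane.continuous_im.comp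
      (continuous_sl_smul continuous_id continuous_const))

lemma continuous_vertical_pt (d : ℝ) : Continuous fun t : I => (vertical (d * t)).pt := by
  rw [UpperHalfPlane.isEmbedding_coe.continuous_iff]
  change Continuous fun t : I => ((Real.exp (d * t) : ℝ) : ℂ) * Complex.I
  fun_prop

end UnitTangent

lemma continuous_geodesicField_pt (h : SL(2, ℝ)) (d : ℝ) :
    Continuous fun t : I => (geodesicField h d t).pt := by
  simp only [geodesicField, sl_smul_pt]
  exact continuous_sl_smul continuous_const (continuous_vertical_pt d)

lemma continuous_geodesicField_dir (h : SL(2, ℝ)) (d : ℝ) :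
    Continuous fun t : I => (geodesicField h d t).dir := by
  refine Continuous.subtype_mk (Continuous.div ?_ ?_ fun g => im_pt_ne_zero _) _
  · change Continuous fun t : I => moebiusDeriv h (vertical (d * t)).pt * (vertical (d * t)).vec
    unfold moebiusDeriv
    have hz : Continuous fun t : I => ((vertical (d * t)).pt : ℂ) :=
      UpperHalfPlane.continuous_coe.comp (continuous_vertical_pt d)
    have hq : Continuous fun t : I =>
        (((h 1 0 : ℝ) : ℂ) * (vertical (d * t)).pt + ((h 1 1 : ℝ) : ℂ)) ^ 2 :=
      ((continuous_const.mul hz).add continuous_const).pow 2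
    refine (Continuous.div continuous_const hq
      fun t => pow_ne_zero 2 (moebius_denom_ne_zero h _)).mul ?_
    change Continuous fun t : I => ((Real.exp (d * t) : ℝ) : ℂ) * Complex.I
    fun_prop
  · exact Complex.continuous_ofReal.comp (UpperHalfPlane.continuous_im.comp
      (continuous_geodesicField_pt h d))

/-- An isometry that fixes `i` and `i eᵈ`, `d > 0`, acts trivially. -/
lemma smul_eq_of_fixes {k : SL(2, ℝ)} {d : ℝ} (hd : 0 < d)
    (h0 : k • (vertical 0).pt = (vertical 0).pt) (h1 : k • (vertical d).pt = (vertical d).pt)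
    (V : UnitTangent) : k • V = V := by
  have hE : 1 < Real.exp d := Real.one_lt_exp_iff.mpr hd
  have key (s : ℝ) (h : k • (vertical s).pt = (vertical s).pt) :
      k 0 1 = -(k 1 0) * Real.exp s ^ 2 ∧ k 0 0 = k 1 1 := by
    have h' : ((k • (vertical s).pt : ℍ) : ℂ) = (vertical s).pt := by rw [h]
    rw [coe_sl_smul, div_eq_iff (moebius_denom_ne_zero k _)] at h'
    change (k 0 0 : ℂ) * ((Real.exp s : ℝ) * Complex.I) + (k 0 1 : ℂ) =
      (Real.exp s : ℝ) * Complex.I *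
        ((k 1 0 : ℂ) * ((Real.exp s : ℝ) * Complex.I) + (k 1 1 : ℂ)) at h'
    have hr := congrArg Complex.re h'
    have hi := congrArg Complex.im h'
    simp [-Complex.ofReal_exp] at hr hi
    exact ⟨by linarith, mul_right_cancel₀ (Real.exp_pos s).ne' (by linarith)⟩
  obtain ⟨a0, a1⟩ := key 0 h0
  obtain ⟨b0, -⟩ := key d h1
  rw [Real.exp_zero] at a0
  have hc : k 1 0 = 0 := by
    have h2 : k 1 0 * (Real.exp d ^ 2 - 1) = 0 := by linarith
    rcases mul_eq_zero.mp h2 with h2 | h2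
    · exact h2
    · nlinarith
  have hb : k 0 1 = 0 := by rw [a0, hc]; ring
  refine center_smul k (Matrix.SpecialLinearGroup.mem_center_iff.mpr ⟨k 0 0, ?_, ?_⟩) V
  · have := k.det_coe
    rw [Matrix.det_fin_two, hb, ← a1] at this
    simpa [sq] using this
  · ext i j
    fin_cases i <;> fin_cases j <;> simp [hb, hc, a1]

/-- Two constant speed geodesics with the same endpoints agree; in the degenerate case, their
constant unit fields differ by a constant rotation. -/
lemma geodesicField_unique {h h' : SL(2, ℝ)} {d d' : ℝ} (hd : 0 ≤ d) (hd' : 0 ≤ d')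
    (e0 : (geodesicField h d 0).pt = (geodesicField h' d' 0).pt)
    (e1 : (geodesicField h d 1).pt = (geodesicField h' d' 1).pt) :
    ∃ φ : ℝ, ∀ t, geodesicField h' d' t = (geodesicField h d t).rotate φ := by
  have hdd : d = d' := by
    have a := dist_geodesicField h d 0 1
    have b := dist_geodesicField h' d' 0 1
    rw [← e0, ← e1, a, abs_of_nonneg hd, abs_of_nonneg hd'] at b
    simpa using b
  subst hdd
  rcases hd.eq_or_lt with rfl | hpos
  · obtain ⟨φ, hφ⟩ := exists_rotate e0
    refine ⟨φ, fun t => ?_⟩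
    have (k : SL(2, ℝ)) (s : ℝ) : geodesicField k 0 s = geodesicField k 0 0 := by
      simp [geodesicField]
    rw [this h', this h, hφ]
  · refine ⟨0, fun t => ?_⟩
    have f0 : (h⁻¹ * h') • (vertical 0).pt = (vertical 0).pt := by
      rw [mul_smul, inv_smul_eq_iff]
      simpa [geodesicField] using! e0.symm
    have f1 : (h⁻¹ * h') • (vertical d).pt = (vertical d).pt := by
      rw [mul_smul, inv_smul_eq_iff]
      simpa [geodesicField] using! e1.symm
    have := smul_eq_of_fixes hpos f0 f1 (vertical (d * t))
    rw [mul_smul, inv_smul_eq_iff] at this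
    change h' • vertical (d * t) = rotate 0 (h • vertical (d * t))
    rw [this]
    ext1
    · rfl
    · simp [rotate]

lemma IsTwist.unique {a : UniversalCover PSL(2, ℝ)} {y : ℍ} {τ τ' : ℝ}
    (h₁ : IsTwist a y τ) (h₂ : IsTwist a y τ') : τ = τ' := by
  obtain ⟨h, d, f, V, hd, hV, hf, θ, hθ, rfl⟩ := h₁
  obtain ⟨h', d', f', V', hd', hV', hf', θ', hθ', rfl⟩ := h₂
  obtain ⟨ψ, rfl⟩ := exists_rotate (hV.trans hV'.symm)
  obtain ⟨H⟩ : ContinuousMap.HomotopicRel (f : C(I, PSL(2, ℝ))) (f' : C(I, PSL(2, ℝ))) {0, 1} :=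
    (pathHomotopy PSL(2, ℝ)).eq.mp (hf.trans hf'.symm)
  have hends (t : I) (ht : t ∈ ({0, 1} : Set I)) :
      (geodesicField h d t).pt = (geodesicField h' d' t).pt := by
    have a : (f : C(I, PSL(2, ℝ))) t • V = (geodesicField h d t).rotate (θ t) := hθ t
    have b : (f' : C(I, PSL(2, ℝ))) t • V.rotate ψ = (geodesicField h' d' t).rotate (θ' t) := hθ' t
    have c : (f : C(I, PSL(2, ℝ))) t = (f' : C(I, PSL(2, ℝ))) t := H.fst_eq_snd ht
    rw [← c, psl_smul_rotate, a] at b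
    have b' := congrArg (fun W : UnitTangent => W.pt) b
    exact b'
  obtain ⟨φ, hφ⟩ := geodesicField_unique hd hd' (by simpa using hends 0 (by simp))
    (by simpa using hends 1 (by simp))
  have a0 (t : I) : ((f : C(I, PSL(2, ℝ))) t • V).dir * ((geodesicField h d t).dir)⁻¹ =
      Circle.exp (θ t) := by
    have := congrArg dir (hθ t)
    rw [dir_rotate] at this
    rw [this, mul_inv_cancel_right]
  have a1 (t : I) : ((f' : C(I, PSL(2, ℝ))) t • V).dir * ((geodesicField h d t).dir)⁻¹ =
      Circle.exp (θ' t + φ - ψ) := by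
    have : ((f' : C(I, PSL(2, ℝ))) t • V.rotate ψ).dir =
        ((geodesicField h' d' t).rotate (θ' t)).dir := congrArg dir (hθ' t)
    rw [hφ, psl_smul_rotate, dir_rotate, dir_rotate, dir_rotate] at this
    rw [Circle.exp_sub, Circle.exp_add, mul_inv_eq_iff_eq_mul, div_mul_eq_mul_div, eq_div_iff_mul_eq',
      mul_comm, this, mul_assoc]
  have hk : Continuous fun t : I => ((geodesicField h d t).dir)⁻¹ :=
    (continuous_geodesicField_dir h d).inv
  have hD : Continuous fun g : PSL(2, ℝ) => (g • V).dir := continuous_psl_dir V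
  let e : C(ℝ, Circle) := ⟨Circle.exp, Circle.exp.continuous⟩
  let γ₀ : C(I, Circle) := e.comp θ
  let γ₁ : C(I, Circle) := e.comp ⟨fun t => θ' t + φ - ψ, by fun_prop⟩
  have hom : γ₀.HomotopicRel γ₁ {0, 1} := ⟨{
    toFun := fun p => ((H p) • V).dir * ((geodesicField h d p.2).dir)⁻¹
    continuous_toFun := (hD.comp H.continuous).mul (hk.comp continuous_snd)
    map_zero_left := fun t => by rw [H.apply_zero]; exact a0 t
    map_one_left := fun t => by rw [H.apply_one]; exact a1 t
    prop' := fun u t ht => by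
      change ((H (u, t)) • V).dir * ((geodesicField h d t).dir)⁻¹ = _
      rw [H.eq_fst u ht]; exact a0 t }⟩
  have h00 : Circle.exp (θ 0) = Circle.exp (θ' 0 + φ - ψ) := hom.fst_eq_snd (by simp)
  have L := Circle.isCoveringMap_exp.liftPath_apply_one_eq_of_homotopicRel hom (θ 0) rfl h00.symm
  have l0 : θ = Circle.isCoveringMap_exp.liftPath γ₀ (θ 0) rfl :=
    (Circle.isCoveringMap_exp.eq_liftPath_iff' rfl).mpr ⟨rfl, rfl⟩
  have l1 : (⟨fun t => θ' t - θ' 0 + θ 0, by fun_prop⟩ : C(I, ℝ)) =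
      Circle.isCoveringMap_exp.liftPath γ₁ (θ 0) h00.symm := by
    refine (Circle.isCoveringMap_exp.eq_liftPath_iff' h00.symm).mpr ⟨?_, ?_⟩
    · funext t
      change Circle.exp (θ' t - θ' 0 + θ 0) = Circle.exp (θ' t + φ - ψ)
      rw [Circle.exp_add, h00, ← Circle.exp_add]
      congr 1
      ring
    · change θ' 0 - θ' 0 + θ 0 = θ 0
      ring
  rw [← l0, ← l1] at L
  change θ 1 = θ' 1 - θ' 0 + θ 0 at L
  linarith

/-- Any two points of the hyperbolic plane are joined by a constant speed geodesic. -/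
lemma exists_geodesicField (y y' : ℍ) : ∃ (h : SL(2, ℝ)) (d : ℝ), 0 ≤ d ∧
    (geodesicField h d 0).pt = y ∧ (geodesicField h d 1).pt = y' := by
  obtain ⟨w, hw⟩ : ∃ w : ℍ, y.toSL2R • w = y' := ⟨y.toSL2R⁻¹ • y', smul_inv_smul _ _⟩
  have hI (φ : ℝ) : rotationMatrix φ • UpperHalfPlane.I = UpperHalfPlane.I := by
    have e : (vertical 0).pt = UpperHalfPlane.I := by
      apply UpperHalfPlane.ext
      simp [vertical]
    have := congrArg pt (rotationMatrix_smul φ (vertical 0) e)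
    rw [← e]
    exact this
  have e0 : (vertical 0).pt = UpperHalfPlane.I := by
    apply UpperHalfPlane.ext
    simp [vertical]
  have hquarter (z : ℍ) : ((rotationMatrix (Real.pi / 2) • z : ℍ) : ℂ) = -1 / (z : ℂ) := by
    rw [coe_sl_smul]
    simp [rotationMatrix]
    rw [neg_div, one_div]
  have hcont : Continuous fun φ : ℝ => (rotationMatrix φ • w).re := by
    exact UpperHalfPlane.continuous_re.comp
      (continuous_sl_smul continuous_rotationMatrix continuous_const)
  have hadd (φ : ℝ) : rotationMatrix (Real.pi / 2) * rotationMatrix φ =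
      rotationMatrix (φ + Real.pi / 2) := by
    ext i j
    rw [Matrix.SpecialLinearGroup.coe_mul]
    fin_cases i <;> fin_cases j <;>
      simp [rotationMatrix, Real.cos_add, Real.sin_add, Matrix.mul_apply, Fin.sum_univ_two]
  -- a rotation about `i` that moves `w` onto the imaginary axis, at or above `i`
  have hrot : ∃ (φ d : ℝ), 0 ≤ d ∧ rotationMatrix φ • w = (vertical d).pt := by
    have r0 : rotationMatrix 0 = 1 := by
      ext i j
      fin_cases i <;> fin_cases j <;> simp [rotationMatrix]
    have hn : 0 < Complex.normSq (w : ℂ) := Complex.normSq_pos.mpr w.ne_zero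
    have v0 : (rotationMatrix 0 • w).re = w.re := by rw [r0, one_smul]
    have v1 : (rotationMatrix (Real.pi / 2) • w).re = -w.re / Complex.normSq (w : ℂ) := by
      rw [← UpperHalfPlane.coe_re, hquarter]
      simp [Complex.div_re]
    have hz : ∃ φ : ℝ, (rotationMatrix φ • w).re = 0 := by
      rcases le_total w.re 0 with hw | hw
      · exact mem_range_of_exists_le_of_exists_ge hcont ⟨0, by rw [v0]; exact hw⟩
          ⟨Real.pi / 2, by rw [v1]; exact div_nonneg (by linarith) hn.le⟩
      · exact mem_range_of_exists_le_of_exists_ge hcont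
          ⟨Real.pi / 2, by rw [v1]; exact div_nonpos_of_nonpos_of_nonneg (by linarith) hn.le⟩
          ⟨0, by rw [v0]; exact hw⟩
    obtain ⟨φ, hφ⟩ := hz
    have hv := (rotationMatrix φ • w).im_pos
    have hc : ((rotationMatrix φ • w : ℍ) : ℂ) =
        ((rotationMatrix φ • w).im : ℂ) * Complex.I := by
      apply Complex.ext
      · simpa using hφ
      · simp
    set v := (rotationMatrix φ • w).im with hvdef
    rcases le_total 1 v with h1 | h1
    · refine ⟨φ, Real.log v, Real.log_nonneg h1, ?_⟩
      apply UpperHalfPlane.ext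
      change _ = ((Real.exp (Real.log v) : ℝ) : ℂ) * Complex.I
      rw [Real.exp_log hv, hc]
    · refine ⟨φ + Real.pi / 2, -Real.log v, by linarith [Real.log_nonpos hv.le h1], ?_⟩
      apply UpperHalfPlane.ext
      change _ = ((Real.exp (-Real.log v) : ℝ) : ℂ) * Complex.I
      have hv' : (v : ℂ) ≠ 0 := by exact_mod_cast hv.ne'
      rw [← hadd, mul_smul, hquarter, hc, Real.exp_neg, Real.exp_log hv, Complex.ofReal_inv,
        div_eq_iff (mul_ne_zero hv' Complex.I_ne_zero)]
      field_simp
      rw [Complex.I_sq]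
  obtain ⟨φ, d, hd, hφ⟩ := hrot
  refine ⟨y.toSL2R * (rotationMatrix φ)⁻¹, d, hd, ?_, ?_⟩
  · change (y.toSL2R * (rotationMatrix φ)⁻¹) • (vertical (d * 0)).pt = y
    rw [mul_zero, e0, mul_smul, inv_smul_eq_iff.mpr (hI φ).symm, UpperHalfPlane.toSL2R_smul_I]
  · change (y.toSL2R * (rotationMatrix φ)⁻¹) • (vertical (d * 1)).pt = y'
    rw [mul_one, ← hφ, mul_smul, inv_smul_smul, hw]

/-- Every element of the universal cover is represented, at every point, by a path of isometries
that moves the point along a constant speed geodesic. -/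
lemma exists_isTwist (a : UniversalCover PSL(2, ℝ)) (y : ℍ) : ∃ τ, IsTwist a y τ := by
  obtain ⟨f, rfl⟩ : ∃ f, UniversalCover.mk f = a := Quotient.exists_rep a
  obtain ⟨V, rfl⟩ : ∃ V : UnitTangent, V.pt = y :=
    ⟨y.toSL2R • vertical 0, by
      change y.toSL2R • (vertical 0).pt = y
      have e0 : (vertical 0).pt = UpperHalfPlane.I := by
        apply UpperHalfPlane.ext
        simp [vertical]
      rw [e0, UpperHalfPlane.toSL2R_smul_I]⟩
  obtain ⟨h, d, hd, h0, h1⟩ :=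
    exists_geodesicField V.pt ((f : C(I, PSL(2, ℝ))) 1 • V).pt
  have hf0 : (f : C(I, PSL(2, ℝ))) 0 = 1 := f.2
  -- the track `w` of the point under `f`, and the geodesic `c`
  let w : I → ℍ := fun t => ((f : C(I, PSL(2, ℝ))) t • V).pt
  let c : I → ℍ := fun t => (geodesicField h d t).pt
  have hw : Continuous w := (continuous_psl_pt V).comp (f : C(I, PSL(2, ℝ))).continuous
  have hc : Continuous c := continuous_geodesicField_pt h d
  have hwc (t : I) (ht : t ∈ ({0, 1} : Set I)) : w t = c t := by
    rcases ht with rfl | rfl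
    · change ((f : C(I, PSL(2, ℝ))) 0 • V).pt = _
      rw [hf0, one_smul, ← h0]
      rfl
    · change ((f : C(I, PSL(2, ℝ))) 1 • V).pt = _
      rw [← h1]
      rfl
  let γ : I × I → ℍ := fun p => ⟨(1 - (p.1 : ℝ)) * (w p.2 : ℂ) + (p.1 : ℝ) * (c p.2 : ℂ), by
    have a := (w p.2).im_pos
    have b := (c p.2).im_pos
    have u0 := p.1.2.1
    have u1 := p.1.2.2
    have : ((1 - (p.1 : ℝ)) * (w p.2 : ℂ) + (p.1 : ℝ) * (c p.2 : ℂ)).im =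
        (1 - (p.1 : ℝ)) * (w p.2).im + (p.1 : ℝ) * (c p.2).im := by
      simp
    rw [this]
    rcases u0.eq_or_lt with e | e
    · rw [← e]; simpa using a
    · have := mul_pos e b
      have := mul_nonneg (sub_nonneg.mpr u1) a.le
      linarith⟩
  have hγ : Continuous γ := by
    rw [UpperHalfPlane.isEmbedding_coe.continuous_iff]
    have w' : Continuous fun p : I × I => (w p.2 : ℂ) :=
      UpperHalfPlane.continuous_coe.comp (hw.comp continuous_snd)
    have c' : Continuous fun p : I × I => (c p.2 : ℂ) :=
      UpperHalfPlane.continuous_coe.comp (hc.comp continuous_snd)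
    have u' : Continuous fun p : I × I => (((p.1 : I) : ℝ) : ℂ) := by fun_prop
    exact ((continuous_const.sub u').mul w').add (u'.mul c')
  let K : I × I → PSL(2, ℝ) := fun p =>
    (((γ p).toSL2R * (w p.2).toSL2R⁻¹ : SL(2, ℝ)) : PSL(2, ℝ)) * (f : C(I, PSL(2, ℝ))) p.2
  have hK : Continuous K := by
    have s1 : Continuous fun p : I × I => (γ p).toSL2R * (w p.2).toSL2R⁻¹ :=
      (UpperHalfPlane.continuous_toSL2R.comp hγ).mul
        (UpperHalfPlane.continuous_toSL2R.comp (hw.comp continuous_snd)).inv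
    exact (QuotientGroup.continuous_mk.comp s1).mul
      ((f : C(I, PSL(2, ℝ))).continuous.comp continuous_snd)
  have γ0 (t : I) : γ (0, t) = w t := by
    apply UpperHalfPlane.ext
    change (1 - ((0 : I) : ℝ)) * (w t : ℂ) + ((0 : I) : ℝ) * (c t : ℂ) = w t
    simp
  have γ1 (t : I) : γ (1, t) = c t := by
    apply UpperHalfPlane.ext
    change (1 - ((1 : I) : ℝ)) * (w t : ℂ) + ((1 : I) : ℝ) * (c t : ℂ) = c t
    simp
  have γends (u t : I) (ht : t ∈ ({0, 1} : Set I)) : γ (u, t) = w t := by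
    apply UpperHalfPlane.ext
    change (1 - (u : ℝ)) * (w t : ℂ) + (u : ℝ) * (c t : ℂ) = w t
    rw [← hwc t ht]
    ring
  have Kw (u t : I) (e : γ (u, t) = w t) : K (u, t) = (f : C(I, PSL(2, ℝ))) t := by
    change (((γ (u, t)).toSL2R * (w t).toSL2R⁻¹ : SL(2, ℝ)) : PSL(2, ℝ)) * _ = _
    rw [e, mul_inv_cancel]
    exact one_mul _
  let f' : PathsFromOne PSL(2, ℝ) :=
    ⟨⟨fun t => K (1, t), hK.comp (Continuous.prodMk continuous_const continuous_id)⟩, by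
      change K (1, 0) = 1
      rw [Kw 1 0 (γends 1 0 (by simp)), hf0]⟩
  have hff : UniversalCover.mk f' = UniversalCover.mk f := by
    refine ((pathHomotopy PSL(2, ℝ)).eq.mpr (ContinuousMap.HomotopicRel.symm ⟨{
      toFun := K
      continuous_toFun := hK
      map_zero_left := fun t => Kw 0 t (γ0 t)
      map_one_left := fun t => rfl
      prop' := fun u t ht => Kw u t (γends u t ht) }⟩))
  have hpt (t : I) : ((f' : C(I, PSL(2, ℝ))) t • V).pt = (geodesicField h d t).pt := by
    change (K (1, t) • V).pt = c t
    have : K (1, t) • V =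
        ((c t).toSL2R * (w t).toSL2R⁻¹ : SL(2, ℝ)) • ((f : C(I, PSL(2, ℝ))) t • V) := by
      rw [← γ1 t]
      exact mul_smul _ _ V
    rw [this]
    change ((c t).toSL2R * (w t).toSL2R⁻¹ : SL(2, ℝ)) • w t = c t
    have e : (w t).toSL2R⁻¹ • w t = UpperHalfPlane.I := by
      rw [inv_smul_eq_iff, UpperHalfPlane.toSL2R_smul_I]
    rw [mul_smul, e, UpperHalfPlane.toSL2R_smul_I]
  let q : C(I, Circle) :=
    ⟨fun t => ((f' : C(I, PSL(2, ℝ))) t • V).dir * ((geodesicField h d t).dir)⁻¹,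
      ((continuous_psl_dir V).comp (f' : C(I, PSL(2, ℝ))).continuous).mul
        (continuous_geodesicField_dir h d).inv⟩
  obtain ⟨θ, hθ, -⟩ := Circle.isCoveringMap_exp.exists_path_lifts q (Complex.arg (q 0))
    (Circle.exp_arg (q 0)).symm
  refine ⟨θ 1 - θ 0, h, d, f', V, hd, rfl, hff, θ, fun t => eq_of_dir (hpt t) ?_, rfl⟩
  have := congrFun hθ t
  change Circle.exp (θ t) =
    ((f' : C(I, PSL(2, ℝ))) t • V).dir * ((geodesicField h d t).dir)⁻¹ at this
  rw [dir_rotate, this, inv_mul_cancel_right]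

theorem existsUnique_isTwist (a : UniversalCover PSL(2, ℝ)) (y : ℍ) : ∃! τ, IsTwist a y τ := by
  obtain ⟨τ, h⟩ := exists_isTwist a y
  exact ⟨τ, h, fun _ h' => h'.unique h⟩

/-- The twist of `a` at the point `y` of the hyperbolic plane. -/
def twist (a : UniversalCover PSL(2, ℝ)) (y : ℍ) : ℝ := (exists_isTwist a y).choose

lemma isTwist_twist (a : UniversalCover PSL(2, ℝ)) (y : ℍ) : IsTwist a y (twist a y) :=
  (exists_isTwist a y).choose_spec

end

noncomputable section

open UnitTangent
open scoped ComplexConjugate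

/-! The Cayley transform conjugates `SL₂(ℝ)` to `SU(1,1)`; let A and B be the diagonal and
off-diagonal entries of the image of g, so that |A|² - |B|² = 1. With the base point at the centre
of the disc, A / conj A is the angle of the rotation in the polar decomposition of g. The twist of a
path class is the total change of this angle along any representative (`IsPolarLift.twist_eq`), so
the special paths over geodesics are no longer needed.

In A(gh) = A(g)A(h) + B(g) conj B(h) the first term dominates, so A(gh) / (A(g)A(h)) has positive
real part, and the polar angle of a product is never opposite to the product of the polar angles
(`polarAngle_mul_ne`). Along paths from 1 the defect of additivity starts at 0 and cannot reach ±π,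
so the twist is a quasimorphism of defect less than π (`abs_twist_mul_sub_lt`). Modulo 2π the defect
depends only on the images in `PSL₂(ℝ)`; hence it vanishes if the product lies over 1
(`twist_mul_of_proj_mul_eq_one`).

The product in the theorem has N = 4g + n factors and lies over 1, so it is a power z^m
(`eq_zGen_zpow_of_proj_eq_one`), of twist 2πm. Of the N - 1 multiplications one is exact, so 2πm
differs from the sum of the twists of the factors by less than (N - 2)π. In that sum the commutators
cancel and the γ's contribute at most nπ. Thus 2π|m| < (4g + 2n - 2)π, that is, |m| < 2g + n - 1,
and m is an integer. -/

/-! ### The rotational part of an isometry -/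

/-- For `g ∈ SL₂(ℝ)`, twice the diagonal entry of the matrix in `SU(1,1)` conjugate to `g` under
the Cayley transform. Its argument is the angle of the rotation in the polar decomposition. -/
def cayleyDiag (g : SL(2, ℝ)) : ℂ := ⟨g 0 0 + g 1 1, g 0 1 - g 1 0⟩

/-- Twice the off-diagonal entry of the matrix in `SU(1,1)` conjugate to `g`. -/
def cayleyOff (g : SL(2, ℝ)) : ℂ := ⟨g 0 0 - g 1 1, -(g 0 1 + g 1 0)⟩

lemma sl_det (g : SL(2, ℝ)) : g 0 0 * g 1 1 - g 0 1 * g 1 0 = 1 := by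
  rw [← Matrix.det_fin_two, g.det_coe]

/-- The determinant in `SU(1,1)` is 1, and both entries are doubled, whence the 4. This makes the
off-diagonal entry strictly smaller than the diagonal one. -/
lemma normSq_cayleyOff_add (g : SL(2, ℝ)) :
    Complex.normSq (cayleyOff g) + 4 = Complex.normSq (cayleyDiag g) := by
  simp only [Complex.normSq_apply, cayleyOff, cayleyDiag]
  linear_combination (-4) * sl_det g

lemma cayleyDiag_ne_zero (g : SL(2, ℝ)) : cayleyDiag g ≠ 0 := by
  intro h
  have := normSq_cayleyOff_add g
  rw [h, map_zero] at this
  linarith [Complex.normSq_nonneg (cayleyOff g)]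

lemma conj_cayleyDiag_ne_zero (g : SL(2, ℝ)) : conj (cayleyDiag g) ≠ 0 :=
  (map_ne_zero _).mpr (cayleyDiag_ne_zero g)

lemma two_mul_cayleyDiag_mul (g h : SL(2, ℝ)) :
    2 * cayleyDiag (g * h) = cayleyDiag g * cayleyDiag h + cayleyOff g * conj (cayleyOff h) := by
  apply Complex.ext <;>
    simp [cayleyDiag, cayleyOff, Matrix.mul_apply, Fin.sum_univ_two] <;> ring

lemma continuous_cayleyDiag : Continuous cayleyDiag :=
  Complex.equivRealProdCLM.symm.continuous.comp
    (((continuous_entry 0 0).add (continuous_entry 1 1)).prodMk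
      ((continuous_entry 0 1).sub (continuous_entry 1 0)))

lemma cayleyDiag_inv (g : SL(2, ℝ)) : cayleyDiag g⁻¹ = conj (cayleyDiag g) := by
  apply Complex.ext <;>
    simp [cayleyDiag, Matrix.SpecialLinearGroup.coe_inv, Matrix.adjugate_fin_two] <;> ring

/-- `A / conj A`, where `A` is the diagonal entry of the matrix in `SU(1,1)` conjugate to `g`. -/
def slPolarAngle (g : SL(2, ℝ)) : Circle :=
  Circle.ofConjDivSelf (conj (cayleyDiag g)) (conj_cayleyDiag_ne_zero g)

lemma coe_slPolarAngle (g : SL(2, ℝ)) :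
    (slPolarAngle g : ℂ) = cayleyDiag g / conj (cayleyDiag g) := by
  change conj (conj (cayleyDiag g)) / _ = _
  rw [Complex.conj_conj]

lemma continuous_slPolarAngle : Continuous slPolarAngle := by
  have h : Continuous fun g => conj (cayleyDiag g) :=
    Complex.continuous_conj.comp continuous_cayleyDiag
  exact Continuous.subtype_mk ((Complex.continuous_conj.comp h).div h conj_cayleyDiag_ne_zero) _

lemma slPolarAngle_one : slPolarAngle 1 = 1 := by
  apply Circle.ext
  have : conj (cayleyDiag 1) = cayleyDiag 1 := by
    rw [← cayleyDiag_inv, inv_one]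
  rw [coe_slPolarAngle, this, div_self (cayleyDiag_ne_zero 1), Circle.coe_one]

lemma slPolarAngle_inv (g : SL(2, ℝ)) : slPolarAngle g⁻¹ = (slPolarAngle g)⁻¹ := by
  apply Circle.ext
  rw [Circle.coe_inv, coe_slPolarAngle, coe_slPolarAngle, cayleyDiag_inv, Complex.conj_conj,
    inv_div]

/-- The cross term vanishes, in particular, if one factor is a rotation about `i`; the diagonal
entries then multiply. -/
lemma slPolarAngle_mul_of_cayleyOff {g h : SL(2, ℝ)} (H : cayleyOff g * conj (cayleyOff h) = 0) :
    slPolarAngle (g * h) = slPolarAngle g * slPolarAngle h := by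
  have e : cayleyDiag (g * h) = cayleyDiag g * cayleyDiag h / 2 := by
    have := two_mul_cayleyDiag_mul g h
    rw [H, add_zero] at this
    rw [← this]
    ring
  apply Circle.ext
  have := conj_cayleyDiag_ne_zero g
  have := conj_cayleyDiag_ne_zero h
  rw [Circle.coe_mul, coe_slPolarAngle, coe_slPolarAngle, coe_slPolarAngle, e]
  simp only [map_div₀, map_mul, Complex.conj_ofNat]
  field_simp

/-- The cross term is smaller in norm than the main term, so the diagonal entry of `g * h` lies in
the open half plane around the product of the diagonal entries. Passing to A / conj A doubles the
angle, so the deviation stays below π. -/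
lemma slPolarAngle_mul_ne (g h : SL(2, ℝ)) :
    (slPolarAngle (g * h) : ℂ) ≠ -(slPolarAngle g * slPolarAngle h) := by
  intro H
  have hg := conj_cayleyDiag_ne_zero g
  have hh := conj_cayleyDiag_ne_zero h
  have hgh := conj_cayleyDiag_ne_zero (g * h)
  rw [coe_slPolarAngle, coe_slPolarAngle, coe_slPolarAngle] at H
  field_simp at H
  set a := cayleyDiag g
  set b := cayleyDiag h
  set u := cayleyOff g
  set v := cayleyOff h
  have e := two_mul_cayleyDiag_mul g h
  -- Cleared of denominators, `H` says w = -conj w for w = A(gh) conj (ab), so w is purely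
  -- imaginary.
  have hre : (2 * cayleyDiag (g * h) * conj (a * b)).re = 0 := by
    have hr := congrArg Complex.re H
    simp only [map_mul, Complex.mul_re, Complex.mul_im, Complex.neg_re, Complex.conj_re,
      Complex.conj_im, Complex.re_ofNat, Complex.im_ofNat] at hr ⊢
    linarith
  rw [e, add_mul, Complex.mul_conj, Complex.add_re, Complex.ofReal_re] at hre
  have h1 : |(u * conj v * conj (a * b)).re| ≤ ‖u‖ * ‖v‖ * (‖a‖ * ‖b‖) := by
    refine (Complex.abs_re_le_norm _).trans_eq ?_
    simp only [norm_mul, map_mul, RCLike.norm_conj]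
  have hu := normSq_cayleyOff_add g
  have hv := normSq_cayleyOff_add h
  rw [Complex.normSq_eq_norm_sq, Complex.normSq_eq_norm_sq] at hu hv
  rw [Complex.normSq_eq_norm_sq, norm_mul] at hre
  change ‖u‖ ^ 2 + 4 = ‖a‖ ^ 2 at hu
  change ‖v‖ ^ 2 + 4 = ‖b‖ ^ 2 at hv
  have ua : ‖u‖ < ‖a‖ := lt_of_pow_lt_pow_left₀ 2 (norm_nonneg _) (by linarith)
  have vb : ‖v‖ < ‖b‖ := lt_of_pow_lt_pow_left₀ 2 (norm_nonneg _) (by linarith)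
  have ha := (norm_nonneg u).trans_lt ua
  have hb := (norm_nonneg v).trans_lt vb
  have h2 : ‖u‖ * ‖v‖ < ‖a‖ * ‖b‖ := mul_lt_mul'' ua vb (norm_nonneg _) (norm_nonneg _)
  have h3 := mul_lt_mul_of_pos_right h2 (mul_pos ha hb)
  have h4 := neg_abs_le (u * conj v * conj (a * b)).re
  nlinarith

lemma cayleyOff_of_mem_center {g : SL(2, ℝ)} (hg : g ∈ Subgroup.center SL(2, ℝ)) :
    cayleyOff g = 0 ∧ slPolarAngle g = 1 := by
  obtain ⟨r, hr, hrg⟩ := Matrix.SpecialLinearGroup.mem_center_iff.mp hg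
  have h2 : r ^ 2 = 1 := by simpa using hr
  have e00 : g 0 0 = r := by rw [← hrg]; simp
  have e01 : g 0 1 = 0 := by rw [← hrg]; simp
  have e10 : g 1 0 = 0 := by rw [← hrg]; simp
  have e11 : g 1 1 = r := by rw [← hrg]; simp
  refine ⟨by apply Complex.ext <;> simp [cayleyOff, e00, e01, e10, e11], ?_⟩
  have hc : conj (cayleyDiag g) = cayleyDiag g := by
    apply Complex.ext <;> simp [cayleyDiag, e01, e10]
  apply Circle.ext
  rw [coe_slPolarAngle, hc, div_self (cayleyDiag_ne_zero g), Circle.coe_one]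

/-- The square of the rotation in the polar decomposition of an element of `PSL₂(ℝ)`. -/
def polarAngle (g : PSL(2, ℝ)) : Circle :=
  Quotient.liftOn' g slPolarAngle fun a b hab => by
    rw [QuotientGroup.leftRel_apply] at hab
    obtain ⟨h0, h1⟩ := cayleyOff_of_mem_center hab
    have := slPolarAngle_mul_of_cayleyOff (g := a) (h := a⁻¹ * b) (by rw [h0]; simp)
    rw [h1, mul_one, mul_inv_cancel_left] at this
    exact this.symm

lemma polarAngle_mk (g : SL(2, ℝ)) : polarAngle (g : PSL(2, ℝ)) = slPolarAngle g := rfl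

lemma continuous_polarAngle : Continuous polarAngle := by
  rw [(QuotientGroup.isQuotientMap_mk (Subgroup.center SL(2, ℝ))).continuous_iff]
  exact continuous_slPolarAngle

lemma polarAngle_one : polarAngle 1 = 1 := slPolarAngle_one

lemma polarAngle_inv (g : PSL(2, ℝ)) : polarAngle g⁻¹ = (polarAngle g)⁻¹ := by
  induction g using QuotientGroup.induction_on with
  | H g => exact slPolarAngle_inv g

lemma polarAngle_mul_ne (g h : PSL(2, ℝ)) :
    (polarAngle (g * h) : ℂ) ≠ -(polarAngle g * polarAngle h) := by
  induction g using QuotientGroup.induction_on with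
  | H g =>
    induction h using QuotientGroup.induction_on with
    | H h => exact slPolarAngle_mul_ne g h

lemma cayleyDiag_rotationMatrix (φ : ℝ) :
    cayleyDiag (rotationMatrix φ) = 2 * Complex.exp (φ * Complex.I) := by
  rw [Complex.exp_mul_I]
  apply Complex.ext <;> simp [cayleyDiag, rotationMatrix, two_mul, Complex.cos_ofReal_re,
    Complex.sin_ofReal_re]

lemma slPolarAngle_rotationMatrix (φ : ℝ) :
    slPolarAngle (rotationMatrix φ) = Circle.exp (2 * φ) := by
  apply Circle.ext
  rw [coe_slPolarAngle, cayleyDiag_rotationMatrix, map_mul, ← Complex.exp_conj, map_mul,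
    Complex.conj_ofReal, Complex.conj_I, Complex.conj_ofNat,
    mul_div_mul_left _ _ two_ne_zero, ← Complex.exp_sub, Circle.coe_exp]
  congr 1
  push_cast
  ring

/-! ### Change of base point. -/

lemma cayleyOff_of_smul_I {k : SL(2, ℝ)} (hk : k • UpperHalfPlane.I = UpperHalfPlane.I) :
    cayleyOff k = 0 := by
  have h' : ((k • UpperHalfPlane.I : ℍ) : ℂ) = UpperHalfPlane.I := by rw [hk]
  rw [coe_sl_smul, div_eq_iff (moebius_denom_ne_zero k _)] at h'
  have hr := congrArg Complex.re h'
  have hi := congrArg Complex.im h'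
  simp at hr hi
  apply Complex.ext
  · simp [cayleyOff]; linarith
  · simp [cayleyOff]; linarith

/-- Multiplication by a rotation about `i` multiplies the polar angle, and `Circle` is commutative,
so the two outer factors cancel. -/
lemma slPolarAngle_conj {k : SL(2, ℝ)} (hk : k • UpperHalfPlane.I = UpperHalfPlane.I)
    (g : SL(2, ℝ)) : slPolarAngle (k⁻¹ * g * k) = slPolarAngle g := by
  have h1 : cayleyOff k⁻¹ = 0 := cayleyOff_of_smul_I (by rw [inv_smul_eq_iff, hk])
  rw [slPolarAngle_mul_of_cayleyOff (by rw [cayleyOff_of_smul_I hk]; simp),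
    slPolarAngle_mul_of_cayleyOff (by rw [h1]; simp), slPolarAngle_inv, mul_comm,
    mul_inv_cancel_left]

lemma polarAngle_conj {k : SL(2, ℝ)} (hk : k • UpperHalfPlane.I = UpperHalfPlane.I)
    (g : PSL(2, ℝ)) : polarAngle ((k : PSL(2, ℝ))⁻¹ * g * (k : PSL(2, ℝ))) = polarAngle g := by
  induction g using QuotientGroup.induction_on with
  | H g => exact slPolarAngle_conj hk g

/-- The polar angle with respect to the point `p` in place of `i`. -/
def polarAngleAt (p : ℍ) (g : PSL(2, ℝ)) : Circle :=
  polarAngle ((p.toSL2R : PSL(2, ℝ))⁻¹ * g * (p.toSL2R : PSL(2, ℝ)))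

lemma continuous_polarAngleAt (p : ℍ) : Continuous (polarAngleAt p) :=
  continuous_polarAngle.comp ((continuous_const.mul continuous_id).mul continuous_const)

/-- Two isometries that take `i` to `p` differ by a rotation about `i`. The frame can therefore be
adapted to whatever geodesic leaves `p`. -/
lemma polarAngleAt_eq {p : ℍ} {h : SL(2, ℝ)} (hp : h • UpperHalfPlane.I = p) (g : PSL(2, ℝ)) :
    polarAngleAt p g = polarAngle ((h : PSL(2, ℝ))⁻¹ * g * (h : PSL(2, ℝ))) := by
  have hk : (p.toSL2R⁻¹ * h) • UpperHalfPlane.I = UpperHalfPlane.I := by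
    rw [mul_smul, hp, inv_smul_eq_iff, UpperHalfPlane.toSL2R_smul_I]
  rw [polarAngleAt, ← polarAngle_conj hk]
  congr 1
  have e : ((p.toSL2R⁻¹ * h : SL(2, ℝ)) : PSL(2, ℝ)) = (p.toSL2R : PSL(2, ℝ))⁻¹ * h := rfl
  rw [e]
  group

lemma polarAngleAt_one (p : ℍ) : polarAngleAt p 1 = 1 := by
  rw [polarAngleAt, mul_one, inv_mul_cancel, polarAngle_one]

lemma polarAngleAt_inv (p : ℍ) (g : PSL(2, ℝ)) : polarAngleAt p g⁻¹ = (polarAngleAt p g)⁻¹ := by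
  rw [polarAngleAt, polarAngleAt, ← polarAngle_inv]
  congr 1
  group

lemma polarAngleAt_mul_ne (p : ℍ) (g h : PSL(2, ℝ)) :
    (polarAngleAt p (g * h) : ℂ) ≠ -(polarAngleAt p g * polarAngleAt p h) := by
  have e : (p.toSL2R : PSL(2, ℝ))⁻¹ * (g * h) * (p.toSL2R : PSL(2, ℝ)) =
      ((p.toSL2R : PSL(2, ℝ))⁻¹ * g * (p.toSL2R : PSL(2, ℝ))) *
        ((p.toSL2R : PSL(2, ℝ))⁻¹ * h * (p.toSL2R : PSL(2, ℝ))) := by group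
  rw [polarAngleAt, e]
  exact polarAngle_mul_ne _ _

/-- The polar angle of a rotation about another point stays in the half circle around the angle
of the rotation. -/
lemma slPolarAngle_conj_rotationMatrix_ne (h : SL(2, ℝ)) (φ : ℝ) :
    (slPolarAngle (h⁻¹ * rotationMatrix φ * h) : ℂ) ≠ -(Circle.exp (2 * φ) : ℂ) := by
  intro H
  have d := sl_det h
  have hc := conj_cayleyDiag_ne_zero (h⁻¹ * rotationMatrix φ * h)
  rw [← slPolarAngle_rotationMatrix, coe_slPolarAngle, coe_slPolarAngle] at H
  have hr := conj_cayleyDiag_ne_zero (rotationMatrix φ)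
  field_simp at H
  -- Conjugation keeps the trace and stretches the imaginary part: the factor 2 becomes the sum of
  -- the squares of the entries of `h`. `H` makes the real part of the product with the conjugate of
  -- the entry in `e'` vanish, but that real part is positive.
  have e : cayleyDiag (h⁻¹ * rotationMatrix φ * h) =
      ⟨2 * Real.cos φ,
        (h 0 0 ^ 2 + h 0 1 ^ 2 + h 1 0 ^ 2 + h 1 1 ^ 2) * Real.sin φ⟩ := by
    apply Complex.ext
    · simp only [cayleyDiag, Matrix.SpecialLinearGroup.coe_mul,
        Matrix.SpecialLinearGroup.coe_inv, Matrix.adjugate_fin_two]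
      simp [rotationMatrix, Matrix.mul_apply, Fin.sum_univ_two]
      linear_combination 2 * Real.cos φ * d
    · simp only [cayleyDiag, Matrix.SpecialLinearGroup.coe_mul,
        Matrix.SpecialLinearGroup.coe_inv, Matrix.adjugate_fin_two]
      simp [rotationMatrix, Matrix.mul_apply, Fin.sum_univ_two]
      ring
  have e' : cayleyDiag (rotationMatrix φ) = ⟨2 * Real.cos φ, 2 * Real.sin φ⟩ := by
    apply Complex.ext <;> simp [cayleyDiag, rotationMatrix, two_mul]
  rw [e, e'] at H
  have hr := congrArg Complex.re H
  simp only [Complex.mul_re, Complex.neg_re, Complex.conj_re, Complex.conj_im] at hr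
  have hs := Real.sin_sq_add_cos_sq φ
  -- The difference of the two sides is (a - d)² + (b + c)², because the determinant is 1.
  have hK : 2 ≤ h 0 0 ^ 2 + h 0 1 ^ 2 + h 1 0 ^ 2 + h 1 1 ^ 2 := by
    nlinarith [sq_nonneg (h 0 0 - h 1 1), sq_nonneg (h 0 1 + h 1 0)]
  have := mul_le_mul_of_nonneg_right hK (sq_nonneg (Real.sin φ))
  nlinarith [sq_nonneg (Real.cos φ)]

/-! ### The action on unit tangent vectors is free -/

lemma vertical_zero_pt : (vertical 0).pt = UpperHalfPlane.I := by
  apply UpperHalfPlane.ext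
  simp [vertical]

lemma rotate_rotate (a b : ℝ) (V : UnitTangent) : (V.rotate a).rotate b = V.rotate (a + b) := by
  ext1
  · rfl
  · change Complex.exp (b * Complex.I) * (Complex.exp (a * Complex.I) * V.vec) =
      Complex.exp ((a + b : ℝ) * Complex.I) * V.vec
    rw [← mul_assoc, ← Complex.exp_add]
    congr 2
    push_cast
    ring

lemma rotate_zero (V : UnitTangent) : V.rotate 0 = V := by
  ext1
  · rfl
  · simp [rotate]

/-- An isometry that fixes `i` has a rotation matrix, and derivative 1 there means (ci + d)² = 1.
The real part d² - c² = 1 and the determinant d² + c² = 1 leave only ±1. -/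
lemma mem_center_of_smul_vertical {k : SL(2, ℝ)} (hk : k • vertical 0 = vertical 0) :
    k ∈ Subgroup.center SL(2, ℝ) := by
  have hpt : k • UpperHalfPlane.I = UpperHalfPlane.I := by
    rw [← vertical_zero_pt]
    exact congrArg pt hk
  have hoff := cayleyOff_of_smul_I hpt
  have o1 : k 0 0 - k 1 1 = 0 := congrArg Complex.re hoff
  have o2 : -(k 0 1 + k 1 0) = 0 := congrArg Complex.im hoff
  have hvec : moebiusDeriv k (vertical 0).pt * (vertical 0).vec = (vertical 0).vec :=
    congrArg vec hk
  have v0 : (vertical 0).vec ≠ 0 := by simp [vertical]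
  have hd := mul_right_cancel₀ v0 (hvec.trans (one_mul _).symm)
  rw [moebiusDeriv, div_eq_one_iff_eq (pow_ne_zero 2 (moebius_denom_ne_zero k _)),
    vertical_zero_pt] at hd
  have hi := congrArg Complex.im hd
  simp [sq] at hi
  have d := sl_det k
  have a : k 0 0 = k 1 1 := by linarith
  have b : k 0 1 = -k 1 0 := by linarith
  have hr := congrArg Complex.re hd
  simp [sq] at hr
  rw [a, b] at d
  have c : k 1 0 = 0 := by nlinarith
  refine Matrix.SpecialLinearGroup.mem_center_iff.mpr ⟨k 1 1, ?_, ?_⟩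
  · rw [c] at d
    simpa [sq] using d
  · ext i j
    fin_cases i <;> fin_cases j <;> simp [a, b, c]

lemma psl_eq_of_smul_vertical {g g' : PSL(2, ℝ)} (h : g • vertical 0 = g' • vertical 0) :
    g = g' := by
  induction g using QuotientGroup.induction_on with
  | H g =>
    induction g' using QuotientGroup.induction_on with
    | H g' =>
      refine QuotientGroup.eq.mpr (mem_center_of_smul_vertical ?_)
      rw [psl_mk_smul, psl_mk_smul] at h
      rw [mul_smul, ← h, inv_smul_smul]

/-! ### The twist as the total change of the polar angle -/

/-- The translation by `s` along the imaginary axis. -/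
def translationMatrix (s : ℝ) : SL(2, ℝ) :=
  ⟨!![Real.exp (s / 2), 0; 0, Real.exp (-(s / 2))], by
    rw [Matrix.det_fin_two_of, ← Real.exp_add]
    simp⟩

lemma translationMatrix_smul (s : ℝ) : translationMatrix s • vertical 0 = vertical s := by
  have h : Real.exp (s / 2) / Real.exp (-(s / 2)) = Real.exp s := by
    rw [← Real.exp_sub]
    congr 1
    ring
  have h' : 1 / Real.exp (-(s / 2)) ^ 2 = Real.exp s := by
    rw [← Real.exp_nat_mul, one_div, ← Real.exp_neg]
    congr 1
    push_cast
    ring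
  ext1
  · change translationMatrix s • (vertical 0).pt = (vertical s).pt
    apply UpperHalfPlane.ext
    rw [coe_sl_smul, vertical_zero_pt]
    change _ = ((Real.exp s : ℝ) : ℂ) * Complex.I
    rw [← h]
    simp [translationMatrix]
    ring
  · change moebiusDeriv (translationMatrix s) (vertical 0).pt * ((Real.exp 0 : ℝ) * Complex.I) =
      ((Real.exp s : ℝ) : ℂ) * Complex.I
    rw [moebiusDeriv, ← h']
    simp [translationMatrix]

lemma slPolarAngle_translationMatrix (s : ℝ) : slPolarAngle (translationMatrix s) = 1 := by
  have hc : conj (cayleyDiag (translationMatrix s)) = cayleyDiag (translationMatrix s) := by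
    apply Complex.ext <;> simp [cayleyDiag, translationMatrix]
  apply Circle.ext
  rw [coe_slPolarAngle, hc, div_self (cayleyDiag_ne_zero _), Circle.coe_one]

lemma rotationMatrix_smul_I (φ : ℝ) : rotationMatrix φ • UpperHalfPlane.I = UpperHalfPlane.I := by
  have := congrArg pt (rotationMatrix_smul φ (vertical 0) vertical_zero_pt)
  rw [← vertical_zero_pt]
  exact this

/-- By freeness, `g` is a rotation about `i` followed by a translation along the imaginary axis. The
translation has real diagonal entry and contributes nothing. The half angle appears because
`rotationMatrix φ` turns by `2 * φ`. -/
lemma polarAngle_of_smul_vertical {g : PSL(2, ℝ)} {s φ : ℝ}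
    (hg : g • vertical 0 = (vertical s).rotate φ) : polarAngle g = Circle.exp φ := by
  have h : g = ((translationMatrix s * rotationMatrix (φ / 2) : SL(2, ℝ)) : PSL(2, ℝ)) := by
    apply psl_eq_of_smul_vertical
    rw [hg, psl_mk_smul, mul_smul, rotationMatrix_smul _ _ vertical_zero_pt, sl_smul_rotate,
      translationMatrix_smul, mul_div_cancel₀ _ two_ne_zero]
  rw [h, polarAngle_mk, slPolarAngle_mul_of_cayleyOff, slPolarAngle_translationMatrix,
    slPolarAngle_rotationMatrix, one_mul, mul_div_cancel₀ _ two_ne_zero]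
  rw [cayleyOff_of_smul_I (rotationMatrix_smul_I _), map_zero, mul_zero]

/-- A continuous choice of the polar angle along a path of isometries, starting at `0`. -/
def IsPolarLift (p : ℍ) (f : PathsFromOne PSL(2, ℝ)) (θ : C(I, ℝ)) : Prop :=
  θ 0 = 0 ∧ ∀ t, Circle.exp (θ t) = polarAngleAt p ((f : C(I, PSL(2, ℝ))) t)

lemma exists_isPolarLift (p : ℍ) (f : PathsFromOne PSL(2, ℝ)) : ∃ θ, IsPolarLift p f θ := by
  have hf0 : (f : C(I, PSL(2, ℝ))) 0 = 1 := f.2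
  let q : C(I, Circle) := ⟨fun t => polarAngleAt p ((f : C(I, PSL(2, ℝ))) t),
    (continuous_polarAngleAt p).comp (f : C(I, PSL(2, ℝ))).continuous⟩
  have q0 : q 0 = Circle.exp 0 := by
    change polarAngleAt p ((f : C(I, PSL(2, ℝ))) 0) = _
    rw [hf0, polarAngleAt_one, Circle.exp_zero]
  obtain ⟨θ, hθ, h0⟩ := Circle.isCoveringMap_exp.exists_path_lifts q 0 q0
  exact ⟨θ, h0, fun t => congrFun hθ t⟩

/-- The polar angle carries a homotopy of paths of isometries to one of paths in the circle, and
lifts of homotopic paths from the same point end together. -/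
lemma IsPolarLift.eq_of_mk_eq {p : ℍ} {f f' : PathsFromOne PSL(2, ℝ)} {θ θ' : C(I, ℝ)}
    (h : IsPolarLift p f θ) (h' : IsPolarLift p f' θ')
    (e : UniversalCover.mk f = UniversalCover.mk f') : θ 1 = θ' 1 := by
  obtain ⟨H⟩ : ContinuousMap.HomotopicRel (f : C(I, PSL(2, ℝ))) (f' : C(I, PSL(2, ℝ))) {0, 1} :=
    (pathHomotopy PSL(2, ℝ)).eq.mp e
  let E : C(ℝ, Circle) := ⟨Circle.exp, Circle.exp.continuous⟩
  have hom : (E.comp θ).HomotopicRel (E.comp θ') {0, 1} := ⟨{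
    toFun := fun x => polarAngleAt p (H x)
    continuous_toFun := (continuous_polarAngleAt p).comp H.continuous
    map_zero_left := fun t => by rw [H.apply_zero]; exact (h.2 t).symm
    map_one_left := fun t => by rw [H.apply_one]; exact (h'.2 t).symm
    prop' := fun u t ht => by
      change polarAngleAt p (H (u, t)) = _
      rw [H.eq_fst u ht]
      exact (h.2 t).symm }⟩
  have h0 : E.comp θ' 0 = Circle.exp 0 := congrArg Circle.exp h'.1
  have L := Circle.isCoveringMap_exp.liftPath_apply_one_eq_of_homotopicRel hom 0
    (congrArg Circle.exp h.1) h0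
  have l0 : θ = Circle.isCoveringMap_exp.liftPath (E.comp θ) 0 (congrArg Circle.exp h.1) :=
    (Circle.isCoveringMap_exp.eq_liftPath_iff' _).mpr ⟨rfl, h.1⟩
  have l1 : θ' = Circle.isCoveringMap_exp.liftPath (E.comp θ') 0 h0 :=
    (Circle.isCoveringMap_exp.eq_liftPath_iff' _).mpr ⟨rfl, h'.1⟩
  rwa [← l0, ← l1] at L

/-- For the representative that moves `p` along the geodesic, the frame `h` turns the geodesic into
the imaginary axis, where the angle from the tangent is the polar angle. Homotopy invariance
transfers this to every representative. -/
lemma IsPolarLift.twist_eq {p : ℍ} {f : PathsFromOne PSL(2, ℝ)} {θ : C(I, ℝ)}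
    (hθ : IsPolarLift p f θ) : twist (UniversalCover.mk f) p = θ 1 := by
  obtain ⟨h, d, f', V, -, hV, hf', θ', hθ', e⟩ := isTwist_twist (UniversalCover.mk f) p
  have key (t : I) : (f' : C(I, PSL(2, ℝ))) t • V = (h • vertical (d * t)).rotate (θ' t) := hθ' t
  have hV0 : V = (h • vertical 0).rotate (θ' 0) := by
    have := key 0
    rwa [show (f' : C(I, PSL(2, ℝ))) 0 = 1 from f'.2, one_smul, Set.Icc.coe_zero, mul_zero] at this
  have hp : h • UpperHalfPlane.I = p := by
    rw [← hV, hV0, ← vertical_zero_pt]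
    rfl
  -- Subtracting `θ' 0` amounts to replacing `V` by the initial tangent vector of the geodesic.
  have lift' : IsPolarLift p f' ⟨fun t => θ' t - θ' 0, by fun_prop⟩ := by
    refine ⟨sub_self _, fun t => ?_⟩
    rw [polarAngleAt_eq hp]
    refine (polarAngle_of_smul_vertical (s := d * t) ?_).symm
    have := key t
    rw [hV0, psl_smul_rotate] at this
    have := congrArg (rotate (-θ' 0)) this
    rw [rotate_rotate, rotate_rotate, add_neg_cancel, rotate_zero, ← sub_eq_add_neg] at this
    rw [mul_smul, mul_smul, psl_mk_smul, this, inv_smul_eq_iff, psl_mk_smul, sl_smul_rotate]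
    rfl
  rw [e]
  exact lift'.eq_of_mk_eq hθ hf'

/-! ### The twist is a quasimorphism -/

/-- By the intermediate value theorem |δ| would take the value π, where the exponential is -1. -/
lemma abs_lt_pi_of_exp_ne {δ : C(I, ℝ)} (h0 : δ 0 = 0)
    (h : ∀ t, (Circle.exp (δ t) : ℂ) ≠ -1) : |δ 1| < Real.pi := by
  by_contra! hpi
  obtain ⟨t, ht⟩ : ∃ t : I, |δ t| = Real.pi :=
    mem_range_of_exists_le_of_exists_ge (by fun_prop : Continuous fun t : I => |δ t|)
      ⟨0, by rw [h0, abs_zero]; exact Real.pi_pos.le⟩ ⟨1, hpi⟩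
  apply h t
  rw [Circle.coe_exp]
  rcases abs_eq Real.pi_pos.le |>.mp ht with e | e <;> rw [e]
  · exact Complex.exp_pi_mul_I
  · rw [Complex.ofReal_neg, neg_mul, Complex.exp_neg, Complex.exp_pi_mul_I, inv_neg, inv_one]

lemma eq_zero_of_exp_eq_one {x : ℝ} (hx : |x| < Real.pi) (h : Circle.exp x = 1) : x = 0 := by
  obtain ⟨k, hk⟩ := Circle.exp_eq_one.mp h
  have hpi := Real.pi_pos
  obtain ⟨h1, h2⟩ := abs_lt.mp hx
  have k1 : k < 1 := by
    by_contra! hc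
    have : (1 : ℝ) ≤ k := by exact_mod_cast hc
    nlinarith
  have k2 : -1 < k := by
    by_contra! hc
    have : (k : ℝ) ≤ -1 := by exact_mod_cast hc
    nlinarith
  rw [hk, show k = 0 by omega]
  simp

lemma mk_mul (f g : PathsFromOne PSL(2, ℝ)) :
    UniversalCover.mk (f * g) = UniversalCover.mk f * UniversalCover.mk g := rfl

/-- The defect is the end value of a continuous argument of the polar angle of the pointwise product
divided by the two polar angles, and this quotient avoids -1. The second part determines the defect
modulo 2π, hence exactly once the quotient at the end is 1. -/
lemma twist_mul_aux (a b : UniversalCover PSL(2, ℝ)) (p : ℍ) :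
    |twist (a * b) p - twist a p - twist b p| < Real.pi ∧
      Circle.exp (twist (a * b) p - twist a p - twist b p) =
        polarAngleAt p (a.proj * b.proj) / polarAngleAt p a.proj / polarAngleAt p b.proj := by
  obtain ⟨f, rfl⟩ : ∃ f, UniversalCover.mk f = a := Quotient.exists_rep a
  obtain ⟨g, rfl⟩ : ∃ g, UniversalCover.mk g = b := Quotient.exists_rep b
  obtain ⟨u, hu⟩ := exists_isPolarLift p f
  obtain ⟨v, hv⟩ := exists_isPolarLift p g
  obtain ⟨w, hw⟩ := exists_isPolarLift p (f * g)
  rw [← mk_mul, hu.twist_eq, hv.twist_eq, hw.twist_eq]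
  have key (t : I) : Circle.exp (w t - u t - v t) =
      polarAngleAt p ((f : C(I, PSL(2, ℝ))) t * (g : C(I, PSL(2, ℝ))) t) /
        polarAngleAt p ((f : C(I, PSL(2, ℝ))) t) / polarAngleAt p ((g : C(I, PSL(2, ℝ))) t) := by
    rw [Circle.exp_sub, Circle.exp_sub, hu.2, hv.2, hw.2]
    rfl
  refine ⟨abs_lt_pi_of_exp_ne (δ := ⟨fun t => w t - u t - v t, by fun_prop⟩) ?_ fun t => ?_, key 1⟩
  · change w 0 - u 0 - v 0 = 0
    rw [hu.1, hv.1, hw.1]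
    simp
  · change (Circle.exp (w t - u t - v t) : ℂ) ≠ -1
    rw [key, Circle.coe_div, Circle.coe_div, div_div, ne_eq,
      div_eq_iff (mul_ne_zero (Circle.coe_ne_zero _) (Circle.coe_ne_zero _)), neg_one_mul]
    exact polarAngleAt_mul_ne p _ _

/-- The twist is a quasimorphism of defect at most `π`. -/
lemma abs_twist_mul_sub_lt (a b : UniversalCover PSL(2, ℝ)) (p : ℍ) :
    |twist (a * b) p - twist a p - twist b p| < Real.pi :=
  (twist_mul_aux a b p).1

lemma twist_mul_of_proj_eq_one {a b : UniversalCover PSL(2, ℝ)} (hb : b.proj = 1) (p : ℍ) :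
    twist (a * b) p = twist a p + twist b p := by
  obtain ⟨h1, h2⟩ := twist_mul_aux a b p
  rw [hb, mul_one, polarAngleAt_one, div_one, div_self'] at h2
  linarith [eq_zero_of_exp_eq_one h1 h2]

lemma twist_mul_of_proj_mul_eq_one {a b : UniversalCover PSL(2, ℝ)} (hab : a.proj * b.proj = 1)
    (p : ℍ) : twist (a * b) p = twist a p + twist b p := by
  obtain ⟨h1, h2⟩ := twist_mul_aux a b p
  rw [eq_inv_of_mul_eq_one_right hab, mul_inv_cancel, polarAngleAt_one, polarAngleAt_inv,
    div_inv_eq_mul, one_div, inv_mul_cancel] at h2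
  linarith [eq_zero_of_exp_eq_one h1 h2]

lemma twist_one (p : ℍ) : twist 1 p = 0 := by
  have := twist_mul_of_proj_eq_one (a := 1) (b := 1) (map_one _) p
  rw [one_mul] at this
  linarith

lemma twist_inv (a : UniversalCover PSL(2, ℝ)) (p : ℍ) : twist a⁻¹ p = -twist a p := by
  have := twist_mul_of_proj_mul_eq_one (a := a) (b := a⁻¹)
    (by rw [map_inv, mul_inv_cancel]) p
  rw [mul_inv_cancel, twist_one] at this
  linarith

/-! ### The twist of the full turn. -/

lemma proj_zGen : zGen.proj = 1 := by
  refine QuotientGroup.eq_one_iff _ |>.mpr (Matrix.SpecialLinearGroup.mem_center_iff.mpr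
    ⟨-1, by simp, ?_⟩)
  ext i j
  fin_cases i <;> fin_cases j <;> simp [rotationMatrix]

/-- The path turns about `i`, not about `p`. Still its polar angle at `p` stays within π of `2 * π *
t`, and at the end the difference is a multiple of 2π, so it is 0. -/
lemma twist_zGen (p : ℍ) : twist zGen p = 2 * Real.pi := by
  obtain ⟨θ, hθ⟩ := exists_isPolarLift p rotationPath
  have key (t : I) : Circle.exp (θ t - 2 * (Real.pi * t)) =
      slPolarAngle (p.toSL2R⁻¹ * rotationMatrix (Real.pi * t) * p.toSL2R) /
        Circle.exp (2 * (Real.pi * t)) := by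
    rw [Circle.exp_sub, hθ.2]
    rfl
  have h1 : |θ 1 - 2 * (Real.pi * ((1 : I) : ℝ))| < Real.pi := by
    refine abs_lt_pi_of_exp_ne (δ := ⟨fun t => θ t - 2 * (Real.pi * t), by fun_prop⟩)
      ?_ fun t => ?_
    · change θ 0 - 2 * (Real.pi * ((0 : I) : ℝ)) = 0
      rw [hθ.1]
      simp
    · change (Circle.exp (θ t - 2 * (Real.pi * t)) : ℂ) ≠ -1
      rw [key, Circle.coe_div, ne_eq, div_eq_iff (Circle.coe_ne_zero _), neg_one_mul]
      exact slPolarAngle_conj_rotationMatrix_ne _ _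
  have h2 : Circle.exp (θ 1 - 2 * (Real.pi * ((1 : I) : ℝ))) = 1 := by
    rw [Circle.exp_sub, hθ.2, show (rotationPath : C(I, PSL(2, ℝ))) 1 = 1 from proj_zGen,
      polarAngleAt_one, Set.Icc.coe_one, mul_one, Circle.exp_two_pi, div_one]
  have := eq_zero_of_exp_eq_one h1 h2
  rw [zGen, hθ.twist_eq]
  simpa [sub_eq_zero] using this

lemma twist_zGen_zpow (m : ℤ) (p : ℍ) : twist (zGen ^ m) p = 2 * Real.pi * m := by
  induction m using Int.induction_on with
  | zero => simp [twist_one]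
  | succ n ih =>
    rw [zpow_add_one, twist_mul_of_proj_eq_one proj_zGen, ih, twist_zGen]
    push_cast
    ring
  | pred n ih =>
    rw [zpow_sub_one, twist_mul_of_proj_eq_one (by rw [map_inv, proj_zGen, inv_one]), ih,
      twist_inv, twist_zGen]
    push_cast
    ring

/-! ### The kernel of the covering projection -/

lemma rotationMatrix_add (a b : ℝ) :
    rotationMatrix (a + b) = rotationMatrix a * rotationMatrix b := by
  ext i j
  rw [Matrix.SpecialLinearGroup.coe_mul]
  fin_cases i <;> fin_cases j <;>
    simp [rotationMatrix, Real.cos_add, Real.sin_add, Matrix.mul_apply, Fin.sum_univ_two] <;> ring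

lemma rotationMatrix_zero : rotationMatrix 0 = 1 := by
  ext i j
  fin_cases i <;> fin_cases j <;> simp [rotationMatrix]

lemma rotationMatrix_zpow (φ : ℝ) (k : ℤ) : rotationMatrix φ ^ k = rotationMatrix (k * φ) := by
  let R : Multiplicative ℝ →* SL(2, ℝ) :=
    { toFun := fun x => rotationMatrix x.toAdd
      map_one' := rotationMatrix_zero
      map_mul' := fun a b => rotationMatrix_add a.toAdd b.toAdd }
  have := map_zpow R (Multiplicative.ofAdd φ) k
  rw [← zsmul_eq_mul]
  exact this.symm

/-- The isometry that takes the vertical unit vector at `i` to the unit vector at `y` with angle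
`θ` from the vertical. -/
def frame (y : ℍ) (θ : ℝ) : PSL(2, ℝ) := ((y.toSL2R * rotationMatrix (θ / 2) : SL(2, ℝ)) : PSL(2, ℝ))

lemma continuous_frame : Continuous fun x : ℍ × ℝ => frame x.1 x.2 :=
  QuotientGroup.continuous_mk.comp
    ((UpperHalfPlane.continuous_toSL2R.comp continuous_fst).mul
      (continuous_rotationMatrix.comp (by fun_prop)))

lemma toSL2R_I : UpperHalfPlane.I.toSL2R = 1 := by
  ext i j
  fin_cases i <;> fin_cases j <;> simp

/-- `toSL2R` acts as an affine map with positive real derivative, which preserves Euclidean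
directions. -/
lemma dir_toSL2R_smul_vertical (y : ℍ) : (y.toSL2R • vertical 0).dir = (vertical 0).dir := by
  have hy : (0 : ℝ) < y.im := y.im_pos
  have hpt : (y.toSL2R • vertical 0).pt = y := by
    rw [sl_smul_pt, vertical_zero_pt, UpperHalfPlane.toSL2R_smul_I]
  have hs : ((√y.im : ℝ) : ℂ) ^ 2 = y.im := by exact_mod_cast Real.sq_sqrt hy.le
  have hy' : (y.im : ℂ) ≠ 0 := by exact_mod_cast hy.ne'
  apply Circle.ext
  rw [coe_dir, coe_dir, hpt, vertical_zero_pt]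
  change moebiusDeriv y.toSL2R (vertical 0).pt * (vertical 0).vec / _ = _
  rw [moebiusDeriv]
  simp [hs]
  field_simp

lemma frame_smul_vertical (y : ℍ) (θ : ℝ) :
    frame y θ • vertical 0 = (y.toSL2R • vertical 0).rotate θ := by
  rw [frame, psl_mk_smul, mul_smul, rotationMatrix_smul _ _ vertical_zero_pt, sl_smul_rotate,
    mul_div_cancel₀ _ two_ne_zero]

/-- Point and direction of the image of `vertical 0` are coordinates on `PSL₂(ℝ)`, which is thus a
half plane times a circle. -/
lemma eq_frame {g : PSL(2, ℝ)} {θ : ℝ}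
    (h : Circle.exp θ = (g • vertical 0).dir * ((vertical 0).dir)⁻¹) :
    g = frame (g • vertical 0).pt θ := by
  apply psl_eq_of_smul_vertical
  rw [frame_smul_vertical]
  refine eq_of_dir ?_ ?_
  · change _ = (g • vertical 0).pt.toSL2R • (vertical 0).pt
    rw [vertical_zero_pt, UpperHalfPlane.toSL2R_smul_I]
  · rw [dir_rotate, dir_toSL2R_smul_vertical, h, inv_mul_cancel_right]

/-- The straight line homotopy in the upper half plane. -/
lemma exists_segment (y y' : ℍ) (s : I) : ∃ z : ℍ, (z : ℂ) = (1 - (s : ℝ)) * y + (s : ℝ) * y' := by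
  refine ⟨⟨(1 - (s : ℝ)) * (y : ℂ) + (s : ℝ) * (y' : ℂ), ?_⟩, rfl⟩
  have e : ((1 - (s : ℝ)) * (y : ℂ) + (s : ℝ) * (y' : ℂ)).im =
      (1 - (s : ℝ)) * y.im + (s : ℝ) * y'.im := by simp
  rw [e]
  have a := y.im_pos
  have b := y'.im_pos
  rcases s.2.1.eq_or_lt with h | h
  · rw [← h]
    simpa using a
  · have := mul_pos h b
    have := mul_nonneg (sub_nonneg.mpr s.2.2) a.le
    linarith

/-- The lifts of the identity are the powers of the full turn. -/
lemma eq_zGen_zpow_of_proj_eq_one {a : UniversalCover PSL(2, ℝ)} (ha : a.proj = 1) :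
    ∃ m : ℤ, a = zGen ^ m := by
  obtain ⟨f, rfl⟩ : ∃ f, UniversalCover.mk f = a := Quotient.exists_rep a
  have f0 : (f : C(I, PSL(2, ℝ))) 0 = 1 := f.2
  have f1 : (f : C(I, PSL(2, ℝ))) 1 = 1 := ha
  let y : I → ℍ := fun t => ((f : C(I, PSL(2, ℝ))) t • vertical 0).pt
  have hy : Continuous y := (continuous_psl_pt _).comp (f : C(I, PSL(2, ℝ))).continuous
  let q : C(I, Circle) :=
    ⟨fun t => ((f : C(I, PSL(2, ℝ))) t • vertical 0).dir * ((vertical 0).dir)⁻¹,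
      ((continuous_psl_dir _).comp (f : C(I, PSL(2, ℝ))).continuous).mul continuous_const⟩
  have q0 : q 0 = Circle.exp 0 := by
    change ((f : C(I, PSL(2, ℝ))) 0 • vertical 0).dir * ((vertical 0).dir)⁻¹ = _
    rw [f0, one_smul, mul_inv_cancel, Circle.exp_zero]
  obtain ⟨θ, hθ, θ0⟩ := Circle.isCoveringMap_exp.exists_path_lifts q 0 q0
  have hf (t : I) : (f : C(I, PSL(2, ℝ))) t = frame (y t) (θ t) := eq_frame (congrFun hθ t)
  -- The exponent is the winding number of the circle coordinate of the loop.
  obtain ⟨m, hm⟩ : ∃ m : ℤ, θ 1 = m * (2 * Real.pi) := by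
    refine Circle.exp_eq_one.mp ((congrFun hθ 1).trans ?_)
    change ((f : C(I, PSL(2, ℝ))) 1 • vertical 0).dir * ((vertical 0).dir)⁻¹ = _
    rw [f1, one_smul, mul_inv_cancel]
  have yends (t : I) (ht : t ∈ ({0, 1} : Set I)) : y t = UpperHalfPlane.I := by
    rw [← vertical_zero_pt]
    rcases ht with rfl | rfl
    · change ((f : C(I, PSL(2, ℝ))) 0 • vertical 0).pt = _
      rw [f0, one_smul]
    · change ((f : C(I, PSL(2, ℝ))) 1 • vertical 0).pt = _
      rw [f1, one_smul]
  have θends (t : I) (ht : t ∈ ({0, 1} : Set I)) : θ t = m * (2 * Real.pi) * t := by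
    rcases ht with rfl | rfl
    · simp [θ0]
    · simp [hm]
  choose z hz using fun x : I × I => exists_segment (y x.2) UpperHalfPlane.I x.1
  have hzc : Continuous z := by
    rw [UpperHalfPlane.isEmbedding_coe.continuous_iff]
    have e : UpperHalfPlane.coe ∘ z =
        fun x : I × I => (1 - ((x.1 : ℝ) : ℂ)) * y x.2 + ((x.1 : ℝ) : ℂ) * UpperHalfPlane.I :=
      funext hz
    rw [e]
    have y' : Continuous fun x : I × I => (y x.2 : ℂ) :=
      UpperHalfPlane.continuous_coe.comp (hy.comp continuous_snd)
    fun_prop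
  have zends (u t : I) (ht : t ∈ ({0, 1} : Set I)) : z (u, t) = UpperHalfPlane.I := by
    apply UpperHalfPlane.ext
    rw [hz, yends t ht]
    ring
  have hz0 (t : I) : z (0, t) = y t := UpperHalfPlane.ext (by rw [hz]; simp)
  have hz1 (t : I) : z (1, t) = UpperHalfPlane.I := UpperHalfPlane.ext (by rw [hz]; simp)
  have hR (t : I) : frame UpperHalfPlane.I (m * (2 * Real.pi) * t) =
      ((rotationPath ^ m : PathsFromOne PSL(2, ℝ)) : C(I, PSL(2, ℝ))) t := by
    have e : (m * (2 * Real.pi) * t : ℝ) / 2 = m * (Real.pi * t) := by ring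
    rw [frame, toSL2R_I, one_mul, e, ← rotationMatrix_zpow]
    let ev : PathsFromOne PSL(2, ℝ) →* PSL(2, ℝ) :=
      { toFun := fun f => (f : C(I, PSL(2, ℝ))) t
        map_one' := rfl
        map_mul' := fun _ _ => rfl }
    exact (map_zpow ev rotationPath m).symm
  refine ⟨m, ?_⟩
  have hpow : zGen ^ m = UniversalCover.mk (rotationPath ^ m) := rfl
  rw [hpow]
  -- The homotopy contracts the point to `i` along segments and straightens the angle linearly to `2
  -- * π * m * t`; both are constant at the ends.
  refine (pathHomotopy PSL(2, ℝ)).eq.mpr ⟨{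
    toFun := fun x => frame (z x) ((1 - (x.1 : ℝ)) * θ x.2 + x.1 * (m * (2 * Real.pi) * x.2))
    continuous_toFun := continuous_frame.comp (hzc.prodMk (by fun_prop))
    map_zero_left := fun t => by
      change frame (z (0, t)) ((1 - ((0 : I) : ℝ)) * θ t + ((0 : I) : ℝ) * _) = _
      rw [hf, hz0]
      simp
    map_one_left := fun t => by
      change frame (z (1, t)) ((1 - ((1 : I) : ℝ)) * θ t + ((1 : I) : ℝ) * _) = _
      rw [← hR, hz1]
      simp
    prop' := fun u t ht => by
      change frame (z (u, t)) ((1 - (u : ℝ)) * θ t + u * (m * (2 * Real.pi) * t)) = _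
      rw [hf, zends u t ht, yends t ht, θends t ht]
      congr 1
      ring }⟩

/-! ### Twists of products -/

/-- Each multiplication costs less than π. The bound is strict only if there is a multiplication;
the weak form starts the induction. -/
lemma abs_twist_list_prod_sub_le (p : ℍ) (x : UniversalCover PSL(2, ℝ))
    (l : List (UniversalCover PSL(2, ℝ))) :
    |twist (x :: l).prod p - ((x :: l).map (twist · p)).sum| ≤ l.length * Real.pi ∧
      (l ≠ [] →
        |twist (x :: l).prod p - ((x :: l).map (twist · p)).sum| < l.length * Real.pi) := by
  induction l generalizing x with
  | nil => simp
  | cons y l ih =>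
    have h1 := (ih y).1
    have h2 := abs_twist_mul_sub_lt x (y :: l).prod p
    have h : |twist (x :: y :: l).prod p - ((x :: y :: l).map (twist · p)).sum| <
        (y :: l).length * Real.pi := by
      rw [List.prod_cons, List.map_cons, List.sum_cons, List.length_cons]
      have e : twist (x * (y :: l).prod) p - (twist x p + ((y :: l).map (twist · p)).sum) =
          (twist (x * (y :: l).prod) p - twist x p - twist (y :: l).prod p) +
            (twist (y :: l).prod p - ((y :: l).map (twist · p)).sum) := by ring
      rw [e]
      refine (abs_add_le _ _).trans_lt ?_
      push_cast
      linarith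
    exact ⟨h.le, fun _ => h⟩

/-- If a product of at least three elements of the universal cover lies over the identity, then
its twist differs from the sum of the twists by less than the area bound for the triangles of a
polygon. -/
lemma abs_twist_prod_sub_lt_of_proj_eq_one (p : ℍ) (L : List (UniversalCover PSL(2, ℝ)))
    (hL : 3 ≤ L.length) (h : L.prod.proj = 1) :
    |twist L.prod p - (L.map (twist · p)).sum| < (L.length - 2) * Real.pi := by
  obtain _ | ⟨x, _ | ⟨y, l⟩⟩ := L
  · simp at hL
  · simp at hL
  · have hl : l ≠ [] := by rintro rfl; simp at hL
    have h2 := (abs_twist_list_prod_sub_le p y l).2 hl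
    rw [List.prod_cons, map_mul] at h
    -- Splitting off the first factor is exact, since the whole product lies over 1. This saves one
    -- π.
    rw [List.prod_cons, twist_mul_of_proj_mul_eq_one h, List.map_cons, List.sum_cons,
      add_sub_add_left_eq_sub]
    refine h2.trans_le (le_of_eq ?_)
    simp only [List.length_cons]
    push_cast
    ring

lemma list_sum_ofFn_abs_le {n : ℕ} (t : Fin n → ℝ) {c : ℝ} (h : ∀ j, |t j| ≤ c) :
    |(List.ofFn t).sum| ≤ n * c := by
  rw [List.sum_ofFn]
  refine (Finset.abs_sum_le_sum_abs _ _).trans ((Finset.sum_le_sum fun j _ => h j).trans ?_)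
  simp

/-- The factors of a product of commutators. -/
lemma exists_commutator_factors (p : ℍ) {g : ℕ} (α β : Fin g → UniversalCover PSL(2, ℝ)) :
    ∃ L : List (UniversalCover PSL(2, ℝ)), L.length = 4 * g ∧
      L.prod = (List.ofFn fun i => α i * β i * (α i)⁻¹ * (β i)⁻¹).prod ∧
        (L.map (twist · p)).sum = 0 := by
  induction g with
  | zero => exact ⟨[], by simp⟩
  | succ g ih =>
    obtain ⟨L, h1, h2, h3⟩ := ih (fun i => α i.succ) (fun i => β i.succ)
    refine ⟨α 0 :: β 0 :: (α 0)⁻¹ :: (β 0)⁻¹ :: L, ?_, ?_, ?_⟩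
    · simp only [List.length_cons, h1]
      ring
    · rw [List.ofFn_succ]
      simp only [List.prod_cons, h2, mul_assoc]
    · simp only [List.map_cons, List.sum_cons, h3, twist_inv]
      ring

end

/-! ### The bound on the exponent. -/

theorem mainTheorem8 (g n : ℕ) (hgn : 2 - 2 * (g : ℤ) - (n : ℤ) < 0) (p : ℍ)
    (α β : Fin g → UniversalCover PSL(2, ℝ)) (γ : Fin n → UniversalCover PSL(2, ℝ))
    (hγ : ∀ j, |twist (γ j) p| ≤ Real.pi)
    (hprod :
      (List.ofFn fun i =>
          (α i).proj * (β i).proj * (α i).proj⁻¹ * (β i).proj⁻¹).prod *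
        (List.ofFn fun j => (γ j).proj).prod = 1) :
    ∃ m : ℤ,
      (List.ofFn fun i => α i * β i * (α i)⁻¹ * (β i)⁻¹).prod * (List.ofFn γ).prod = zGen ^ m ∧
        |m| ≤ 2 * (g : ℤ) + (n : ℤ) - 2 ∧
        2 * (g : ℤ) + (n : ℤ) - 2 = |2 - 2 * (g : ℤ) - (n : ℤ)| := by
  obtain ⟨L, hlen, hLprod, hsum⟩ := exists_commutator_factors p α β
  have hproj : (L ++ List.ofFn γ).prod.proj = 1 := by
    rw [List.prod_append, hLprod, map_mul, map_list_prod, map_list_prod, List.map_ofFn,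
      List.map_ofFn, ← hprod]
    congr 3
    funext i
    simp only [Function.comp_apply, map_mul, map_inv]
  obtain ⟨m, hm⟩ := eq_zGen_zpow_of_proj_eq_one hproj
  have hlen' : (L ++ List.ofFn γ).length = 4 * g + n := by
    rw [List.length_append, hlen, List.length_ofFn]
  have h1 := abs_twist_prod_sub_lt_of_proj_eq_one p (L ++ List.ofFn γ) (by omega) hproj
  have h2 := list_sum_ofFn_abs_le (fun j => twist (γ j) p) hγ
  rw [hm, twist_zGen_zpow, hlen', List.map_append, List.sum_append, hsum, zero_add,
    List.map_ofFn] at h1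
  change |2 * Real.pi * m - (List.ofFn fun j => twist (γ j) p).sum| < _ at h1
  refine ⟨m, by rw [← hm, List.prod_append, hLprod], ?_, ?_⟩
  -- The constant is (4g + n - 2)π from the defects plus nπ from the twists of the `γ j`.
  · have h3 : |2 * Real.pi * (m : ℝ)| < (4 * g + 2 * n - 2) * Real.pi := by
      have := abs_add_le (2 * Real.pi * m - (List.ofFn fun j => twist (γ j) p).sum)
        (List.ofFn fun j => twist (γ j) p).sum
      rw [sub_add_cancel] at this
      push_cast at h1
      linarith
    rw [abs_mul, abs_of_pos Real.two_pi_pos] at h3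
    have h4 : |(m : ℝ)| < 2 * g + n - 1 := by
      have hpi := Real.pi_pos
      nlinarith
    -- Strictness of the defect bound is essential: for integers it lowers the bound to 2g + n - 2.
    have h5 : |m| < 2 * (g : ℤ) + n - 1 := by exact_mod_cast h4
    omega
  · rw [abs_of_neg hgn]
    ring
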